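/- Fix $a\in\mathbb R$ and constants $0<\underline\beta\le\overline\beta$, $0<\underline\eta\le\overline\eta$, $\overline\nu>0$. Let $h:\mathbb R\to[0,\infty)$ be measurable and bounded, non-decreasing on $[a,c)$ and non-increasing on $(c,\infty)$ for some $a\le c\le\infty$. Consider the program $$\text{(R)}\qquad \max_f\int_a^\infty h(x)f(x)\,dx\quad\text{s.t.}\quad \underline\beta\le\int_a^\infty f\le\overline\beta,\quad \underline\eta\le f(a)=f(a+)\le\overline\eta,\quad f'_+(a)\ge-\overline\nu,\quad f\text{ convex and }\ge0\text{ on }[a,\infty),$$ with optimal value (supremum) $Z^*$. Let $\mathcal{PL}_2^+$ be the set of non-negative continuous functions $f$ on $[a,\infty)$ for which there are $a=y_0\le y_1\le y_2<\infty$ and $c_j,d_j\in\mathbb R$ with $f(x)=c_j+d_jx$ on $[y_{j-1},y_j]$ for $j=1,2$ and $f(x)=0$ for $x>y_2$. Put $H(x)=\int_0^x\int_0^u h(v+a)\,dv\,du$, $\underline\mu=\underline\eta/\overline\nu$, $\overline\mu=\overline\eta/\overline\nu$, $\underline\sigma=2\underline\beta/\overline\nu$, $\overline\sigma=2\overline\beta/\overline\nu$.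 Then: 1. If (R) is feasible, then either (i) an optimal solution $f^*\in\mathcal{PL}_2^+$ exists, or (ii) no optimal solution exists and there are feasible $f^{(k)}\in\mathcal{PL}_2^+$ with $\int_a^\infty hf^{(k)}\to Z^*$ whose last line segments $c_2^{(k)}+d_2^{(k)}x$ on $[y_1^{(k)},y_2^{(k)}]$ are non-degenerate ($y_1^{(k)}<y_2^{(k)}$, $d_2^{(k)}<0$) and satisfy $y_2^{(k)}\nearrow\infty$ and $|d_2^{(k)}|\searrow0$. Suppose from now on that $\underline\eta^2<2\overline\beta\,\overline\nu$ and that $\lambda=\lim_{x\to\infty}H(x)/x^2$ exists and is finite. For $x\neq\omega$ define $$\mathcal W(x,\omega,\rho)=\overline\nu\left(\frac{\rho-\omega^2}{\rho-2\omega x+x^2}H(x)+\frac{(\omega-x)^2}{\rho-2\omega x+x^2}H\!\left(\frac{\rho-\omega x}{\omega-x}\right)\right),\qquad \mathcal W(\omega,\omega,\rho)=\overline\nu\,(H(\omega)+\lambda(\rho-\omega^2)),$$ and let $\mathcal K(x;x_1,\omega,\rho)$ be $\overline\nu\omega-\overline\nu(x-a)$ for $a\le x\le x_1+a$, $\ \overline\nu\omega-\overline\nu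 x_1-\overline\nu\frac{(\omega-x_1)^2}{\rho-2\omega x_1+x_1^2}(x-a-x_1)$ for $x_1+a\le x\le\frac{\rho-\omega x_1}{\omega-x_1}+a$, and $0$ for larger $x$. Let $$M_1=\max_{\rho\in[\underline\sigma\vee\overline\mu^2,\overline\sigma],\,x_1\in[0,\overline\mu]}\mathcal W(x_1,\overline\mu,\rho),\qquad M_2=\max_{\omega\in[\underline\mu,\overline\mu\wedge\sqrt{\overline\sigma}],\,x_1\in[0,\omega]}\mathcal W(x_1,\omega,\overline\sigma),$$ where $M_1=-\infty$ if its range is empty (i.e. $\overline\mu^2>\overline\sigma$). 2. The range of $M_2$ is non-empty, the maxima over non-empty ranges are attained, and $Z^*=\max\{M_1,M_2\}$. 3. Suppose $M_1\ge M_2$. For every maximizer $(\rho^*,x_1^*)$ of $M_1$ with $x_1^*<\overline\mu$, $f^*(x)=\mathcal K(x;x_1^*,\overline\mu,\rho^*)$ is an optimal solution of (R). If there is no such maximizer, there are feasible $f^{(k)}$ with $\int_a^\infty hf^{(k)}\to Z^*$ and $f^{(k)}\to f^*$ pointwise on $[a,\infty)$, where $f^*(x)=\overline\eta-\overline\nu(x-a)$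 for $a\le x\le\overline\mu+a$ and $f^*(x)=0$ for $x\geq\overline\mu+a$; this can occur only when $\lambda>0$. Suppose instead $M_1<M_2$. For every maximizer $(\omega^*,x_1^*)$ of $M_2$ with $x_1^*<\omega^*$, $f^*(x)=\mathcal K(x;x_1^*,\omega^*,\overline\sigma)$ is an optimal solution of (R). If there is no such maximizer, then there are maximizers of the form $(\omega^*,\omega^*)$, and for each of them there are feasible $f^{(k)}$ with $\int_a^\infty hf^{(k)}\to Z^*$ and $f^{(k)}\to f^*$ pointwise on $[a,\infty)$, where $f^*(x)=\overline\nu\omega^*-\overline\nu(x-a)$ for $a\le x\le\omega^*+a$ and $f^*(x)=0$ for $x\geq\omega^*+a$; this can occur only when $\lambda>0$. -/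

import Mathlib

open MeasureTheory Set Filter Topology

noncomputable section

namespace TailOpt

/-- The numerical inputs: the threshold `a`, the interval `[βl, βu]` for the tail mass, the interval
`[ηl, ηu]` for the density at `a`, and the bound `ν` (the right derivative at `a` is `≥ -ν`). -/
structure Params where
  a : ℝ
  βl : ℝ
  βu : ℝ
  ηl : ℝ
  ηu : ℝ
  ν : ℝ

/-- `h : ℝ → ℝ⁺` is bounded, non-decreasing on `[a, c)` and non-increasing on `(c, ∞)`,
for some `a ≤ c ≤ ∞`. -/
def QuasiConcave (a : ℝ) (h : ℝ → ℝ) : Prop :=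
  (∀ x, 0 ≤ h x) ∧ (∃ M, ∀ x, h x ≤ M) ∧
  ∃ c : EReal, (a : EReal) ≤ c ∧
    MonotoneOn h {x : ℝ | a ≤ x ∧ (x : EReal) < c} ∧
    AntitoneOn h {x : ℝ | c < (x : EReal)}

/-- `H(x) = ∫₀ˣ ∫₀ᵘ h(v + a) dv du`. -/
def H (a : ℝ) (h : ℝ → ℝ) (x : ℝ) : ℝ :=
  ∫ u in (0 : ℝ)..x, ∫ v in (0 : ℝ)..u, h (v + a)

/-- `(y, c, d)` exhibits `f` as a non-negative continuous function on `[a, ∞)` that is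
`c j + d j * x` on the `j`-th of `m` consecutive segments from `a = y 0` to `y m`,
and vanishes beyond `y m`. -/
structure IsPiecewiseLinear (a : ℝ) (m : ℕ) (f : ℝ → ℝ)
    (y : Fin (m + 1) → ℝ) (c d : Fin m → ℝ) : Prop where
  continuousOn : ContinuousOn f (Ici a)
  nonneg : ∀ x, a ≤ x → 0 ≤ f x
  start : y 0 = a
  mono : Monotone y
  segment : ∀ j : Fin m, ∀ x ∈ Icc (y j.castSucc) (y j.succ), f x = c j + d j * x
  vanish : ∀ x, y (Fin.last m) < x → f x = 0

/-- The class of non-negative continuous piecewise linear functions on `[a, ∞)` with at most `m`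
line segments before vanishing. -/
def PL (a : ℝ) (m : ℕ) : Set (ℝ → ℝ) :=
  {f | ∃ y c d, IsPiecewiseLinear a m f y c d}

namespace Params

variable (P : Params) (h : ℝ → ℝ)

def μl : ℝ := P.ηl / P.ν
def μu : ℝ := P.ηu / P.ν
def σl : ℝ := 2 * P.βl / P.ν
def σu : ℝ := 2 * P.βu / P.ν

/-- Feasibility for the relaxed program. Only the values of `f` on `[a, ∞)` matter. -/
structure Feasible (f : ℝ → ℝ) : Prop where
  integrable : IntegrableOn f (Ici P.a)
  mass : (∫ x in Ici P.a, f x) ∈ Icc P.βl P.βu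
  value : f P.a ∈ Icc P.ηl P.ηu
  rightCont : Tendsto f (𝓝[>] P.a) (𝓝 (f P.a))
  rightDeriv : ∃ s, HasDerivWithinAt f s (Ici P.a) P.a ∧ -P.ν ≤ s
  convex : ConvexOn ℝ (Ici P.a) f
  nonneg : ∀ x, P.a ≤ x → 0 ≤ f x

/-- The objective `∫ₐ^∞ h(x) f(x) dx`. -/
def obj (f : ℝ → ℝ) : ℝ := ∫ x in Ici P.a, h x * f x

/-- The optimal value of the relaxed program. -/
def optValue : EReal := ⨆ f ∈ {f : ℝ → ℝ | P.Feasible f}, (P.obj h f : EReal)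

/-- `f` is an optimal solution of the relaxed program. -/
def IsOptimal (f : ℝ → ℝ) : Prop :=
  P.Feasible f ∧ ∀ g, P.Feasible g → P.obj h g ≤ P.obj h f

/-- `(f k)` is a sequence of feasible solutions whose objective values tend to the optimal value. -/
def IsOptimizingSeq (f : ℕ → ℝ → ℝ) : Prop :=
  (∀ k, P.Feasible (f k)) ∧
    Tendsto (fun k => (P.obj h (f k) : EReal)) atTop (𝓝 (P.optValue h))

/-- The function `𝒲(x, ω, ρ)`, where `lam = lim H(x) / x²`. -/
def W (lam x ω ρ : ℝ) : ℝ :=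
  if x = ω then P.ν * (H P.a h ω + lam * (ρ - ω ^ 2))
  else P.ν * ((ρ - ω ^ 2) / (ρ - 2 * ω * x + x ^ 2) * H P.a h x
    + (ω - x) ^ 2 / (ρ - 2 * ω * x + x ^ 2) * H P.a h ((ρ - ω * x) / (ω - x)))

/-- The two-piece density `𝒦(x; x₁, ω, ρ)`. -/
def K (x₁ ω ρ : ℝ) (x : ℝ) : ℝ :=
  if x ≤ x₁ + P.a then P.ν * ω - P.ν * (x - P.a)
  else if x ≤ (ρ - ω * x₁) / (ω - x₁) + P.a then
    P.ν * ω - P.ν * x₁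
      - P.ν * ((ω - x₁) ^ 2 / (ρ - 2 * ω * x₁ + x₁ ^ 2)) * (x - P.a - x₁)
  else 0

/-- The one-piece function `νω - ν(x - a)` on `[a, ω + a]`, and `0` beyond. -/
def triangle (ω : ℝ) (x : ℝ) : ℝ :=
  if x ≤ ω + P.a then P.ν * ω - P.ν * (x - P.a) else 0

/-- The pairs `(ρ, x₁)` of the first maximization; empty when `μu² > σu`. -/
def R₁ : Set (ℝ × ℝ) :=
  {q | q.1 ∈ Icc (max P.σl (P.μu ^ 2)) P.σu ∧ q.2 ∈ Icc 0 P.μu}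

/-- The pairs `(ω, x₁)` of the second maximization. -/
def R₂ : Set (ℝ × ℝ) :=
  {q | q.1 ∈ Icc P.μl (min P.μu (Real.sqrt P.σu)) ∧ q.2 ∈ Icc 0 q.1}

def W₁ (lam : ℝ) (q : ℝ × ℝ) : ℝ := P.W h lam q.2 P.μu q.1
def W₂ (lam : ℝ) (q : ℝ × ℝ) : ℝ := P.W h lam q.2 q.1 P.σu

/-- The value of the first maximization (`-∞` when there is no admissible pair). -/
def M₁ (lam : ℝ) : EReal := ⨆ q ∈ P.R₁, (P.W₁ h lam q : EReal)
/-- The value of the second maximization. -/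
def M₂ (lam : ℝ) : EReal := ⨆ q ∈ P.R₂, (P.W₂ h lam q : EReal)

def Argmax₁ (lam : ℝ) : Set (ℝ × ℝ) := {q ∈ P.R₁ | IsMaxOn (P.W₁ h lam) P.R₁ q}
def Argmax₂ (lam : ℝ) : Set (ℝ × ℝ) := {q ∈ P.R₂ | IsMaxOn (P.W₂ h lam) P.R₂ q}

end Params

end TailOpt

end

noncomputable section

namespace TailOpt

/-! Shift the origin to `a` and divide by `ν`. A feasible function becomes a convex `F` with slope
at least `-1`, value `ω` at `0` and mass `ρ / 2`. Such an `F` is an average of tents `(t - x)⁺` over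
a probability law of `t` with mean `ω` and second moment `ρ`. The objective is, up to `ν`, the mean
of `H(t)`, because the weight integrates against a tent to `H(t)`. The law enters only as
motivation: the claim that two-point laws suffice is proved by comparing densities directly.

If the weight has a finite mode `c`, tune the lower node `x₁` so that the mixture has the same mass
beyond `c` as `F`. Between the nodes `F - mix` is convex, and outside them it is nonnegative, so on
each side of `c` passing to the mixture moves mass towards the mode (`IsTail.exists_mix_of_mode`).
If the weight is non-decreasing throughout, the best limit is to keep the tent at `ω` and send the
excess mass to infinity; some mixture does at least as well as `F`
(`IsTail.exists_mix_of_monotone`).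

The value of a mixture extends continuously to `x₁ = ω`, where the upper node escapes to infinity
and the quadratic growth rate `λ` of `H` enters (`continuousOn_val`). Stretching all nodes by a
common factor cannot hurt, as `H` is non-decreasing, so either `ω` or `ρ` may be pushed to its upper
bound (`Standing.exists_W_ge`). Compactness then gives maximizers. One with `x₁ < ω` is a genuine
optimal two-piece function; one with `x₁ = ω` is only a limit of feasible two-piece functions. -/

/-- The positive part of `t - x`. -/
def tent (t x : ℝ) : ℝ := max (t - x) 0

lemma tent_nonneg (t x : ℝ) : 0 ≤ tent t x := le_max_right _ _

lemma tent_of_le {t x : ℝ} (hx : x ≤ t) : tent t x = t - x := max_eq_left (by linarith)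

lemma tent_of_ge {t x : ℝ} (hx : t ≤ x) : tent t x = 0 := max_eq_right (by linarith)

lemma continuous_tent (t : ℝ) : Continuous (tent t) := by
  unfold tent; fun_prop

lemma convexOn_tent (t : ℝ) : ConvexOn ℝ univ (tent t) := by
  refine ConvexOn.sup ?_ (convexOn_const _ convex_univ)
  refine ⟨convex_univ, fun x _ y _ p q _ _ hpq => le_of_eq ?_⟩
  simp only [smul_eq_mul]
  linear_combination (-t) * hpq

lemma tent_eq_indicator (t : ℝ) : tent t = (Iic t).indicator (fun x => t - x) := by
  funext x
  by_cases hx : x ≤ t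
  · rw [tent_of_le hx, indicator_of_mem (by exact hx)]
  · rw [tent_of_ge (not_le.1 hx).le, indicator_of_notMem (by exact hx)]

lemma integrableOn_tent (c t : ℝ) : IntegrableOn (tent t) (Ioi c) := by
  rw [tent_eq_indicator, IntegrableOn, integrable_indicator_iff measurableSet_Iic, IntegrableOn,
    Measure.restrict_restrict measurableSet_Iic, Iic_inter_Ioi]
  exact ((continuous_const.sub continuous_id).integrableOn_Icc (a := c) (b := t)).mono_set
    Ioc_subset_Icc_self

lemma integral_tent (c t : ℝ) : ∫ x in Ioi c, tent t x = (max (t - c) 0) ^ 2 / 2 := by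
  rw [tent_eq_indicator, integral_indicator measurableSet_Iic,
    Measure.restrict_restrict measurableSet_Iic, Iic_inter_Ioi]
  rcases le_total c t with h | h
  · rw [← intervalIntegral.integral_of_le h, max_eq_left (by linarith)]
    rw [intervalIntegral.integral_sub intervalIntegrable_const
      intervalIntegral.intervalIntegrable_id, intervalIntegral.integral_const, integral_id,
      smul_eq_mul]
    ring
  · rw [Ioc_eq_empty (by linarith), max_eq_right (by linarith)]; simp

/-! ### Integrating a bounded weight against a tent -/

/-- The double primitive of `k` vanishing to first order at `0`. -/
def dblPrim (k : ℝ → ℝ) (t : ℝ) : ℝ := ∫ u in (0 : ℝ)..t, ∫ v in (0 : ℝ)..u, k v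

variable {k : ℝ → ℝ} {M : ℝ}

lemma integrableOn_bdd_mul (hk : Measurable k) (hM : ∀ x, |k x| ≤ M) {f : ℝ → ℝ} {s : Set ℝ}
    (hf : IntegrableOn f s) : IntegrableOn (fun x => k x * f x) s :=
  Integrable.bdd_mul (c := M) hf hk.aestronglyMeasurable (Eventually.of_forall hM)

lemma intervalIntegrable_of_bdd (hk : Measurable k) (hM : ∀ x, |k x| ≤ M) (s t : ℝ) :
    IntervalIntegrable k volume s t := by
  rw [intervalIntegrable_iff]
  exact Measure.integrableOn_of_bounded (M := M) (by simp) hk.aestronglyMeasurable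
    (Eventually.of_forall hM)

/-- Fubini on the triangle `0 < v ≤ u ≤ t`: integrating out `u` first leaves the factor `t - v`.
This turns the objective of a mixture of tents into a combination of values of `H`. -/
lemma integral_mul_tent (hk : Measurable k) (hM : ∀ x, |k x| ≤ M) {t : ℝ} (ht : 0 ≤ t) :
    ∫ x in Ioi 0, k x * tent t x = dblPrim k t := by
  have hl : ∫ x in Ioi 0, k x * tent t x = ∫ x in Ioc 0 t, k x * (t - x) := by
    have : (fun x => k x * tent t x) = (Iic t).indicator (fun x => k x * (t - x)) := by
      rw [tent_eq_indicator]; funext x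
      by_cases hx : x ∈ Iic t <;> simp [hx]
    rw [this, integral_indicator measurableSet_Iic,
      Measure.restrict_restrict measurableSet_Iic, Iic_inter_Ioi]
  have hms : MeasurableSet {z : ℝ × ℝ | z.2 ≤ z.1} := measurableSet_le measurable_snd measurable_fst
  have hswap := integral_integral_swap (μ := volume.restrict (Ioc 0 t))
    (ν := volume.restrict (Ioc 0 t)) (f := fun u v => if v ≤ u then k v else 0) (by
      refine Integrable.of_bound (C := M) ?_ ?_
      · exact (Measurable.ite hms (hk.comp measurable_snd) measurable_const).aestronglyMeasurable
      · refine Eventually.of_forall fun z => ?_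
        have h0 : 0 ≤ M := (abs_nonneg _).trans (hM 0)
        simp only [Function.uncurry]
        split_ifs
        · exact hM _
        · simpa using h0)
  rw [hl, dblPrim, intervalIntegral.integral_of_le ht]
  refine Eq.trans ?_ (Eq.trans hswap.symm ?_)
  · refine setIntegral_congr_fun measurableSet_Ioc fun v hv => ?_
    have : (fun u => if v ≤ u then k v else 0) = (Ici v).indicator (fun _ => k v) := by
      funext u; simp [indicator]
    simp only [this]
    rw [integral_indicator measurableSet_Ici, Measure.restrict_restrict measurableSet_Ici]
    have : Ici v ∩ Ioc 0 t = Icc v t := by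
      ext u; simp only [mem_inter_iff, mem_Ici, mem_Ioc, mem_Icc]
      exact ⟨fun h => ⟨h.1, h.2.2⟩, fun h => ⟨h.1, lt_of_lt_of_le hv.1 h.1, h.2⟩⟩
    rw [this, setIntegral_const, Real.volume_real_Icc_of_le hv.2, smul_eq_mul, mul_comm]
  · refine setIntegral_congr_fun measurableSet_Ioc fun u hu => ?_
    have : (fun v => if v ≤ u then k v else 0) = (Iic u).indicator k := by
      funext v; simp [indicator]
    simp only [this]
    rw [integral_indicator measurableSet_Iic, Measure.restrict_restrict measurableSet_Iic,
      Iic_inter_Ioc_of_le hu.2, intervalIntegral.integral_of_le hu.1.le]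

lemma continuous_dblPrim (hk : Measurable k) (hM : ∀ x, |k x| ≤ M) : Continuous (dblPrim k) := by
  refine intervalIntegral.continuous_primitive (fun s t => ?_) 0
  exact (intervalIntegral.continuous_primitive
    (fun s t => intervalIntegrable_of_bdd hk hM s t) 0).intervalIntegrable s t

/-! ### The two-point mixtures -/

/-- The mixture of two tents with nodes `x₁` and `(ρ - ω x₁) / (ω - x₁)` which has value `ω` at `0`
and mass `ρ / 2`. -/
def mix (x₁ ω ρ y : ℝ) : ℝ :=
  (ρ - ω ^ 2) / (ρ - 2 * ω * x₁ + x₁ ^ 2) * tent x₁ y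
    + (ω - x₁) ^ 2 / (ρ - 2 * ω * x₁ + x₁ ^ 2) * tent ((ρ - ω * x₁) / (ω - x₁)) y

/-- The second node of `mix`. -/
def node (x₁ ω ρ : ℝ) : ℝ := (ρ - ω * x₁) / (ω - x₁)

/-- The weight of the second node of `mix`. -/
def wt (x₁ ω ρ : ℝ) : ℝ := (ω - x₁) ^ 2 / (ρ - 2 * ω * x₁ + x₁ ^ 2)

section mix

variable {x₁ ω ρ : ℝ}

/-- The denominator is `(ρ - ω ^ 2) + (ω - x₁) ^ 2`. -/
lemma denom_pos (hx : x₁ < ω) (hρ : ω ^ 2 ≤ ρ) : 0 < ρ - 2 * ω * x₁ + x₁ ^ 2 := by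
  have : 0 < (ω - x₁) ^ 2 := by have := sub_pos.2 hx; positivity
  nlinarith

lemma wt_pos (hx : x₁ < ω) (hρ : ω ^ 2 ≤ ρ) : 0 < wt x₁ ω ρ :=
  div_pos (by have := sub_pos.2 hx; positivity) (denom_pos hx hρ)

lemma wt_le_one (hx : x₁ < ω) (hρ : ω ^ 2 ≤ ρ) : wt x₁ ω ρ ≤ 1 := by
  rw [wt, div_le_one (denom_pos hx hρ)]; nlinarith

lemma mix_eq (hx : x₁ < ω) (hρ : ω ^ 2 ≤ ρ) (y : ℝ) :
    mix x₁ ω ρ y = (1 - wt x₁ ω ρ) * tent x₁ y + wt x₁ ω ρ * tent (node x₁ ω ρ) y := by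
  have := (denom_pos hx hρ).ne'
  rw [mix, wt, node]
  congr 2
  rw [eq_sub_iff_add_eq, ← add_div, div_eq_one_iff_eq this]; ring

lemma node_eq (hx : x₁ < ω) : node x₁ ω ρ = ω + (ρ - ω ^ 2) / (ω - x₁) := by
  have := (sub_pos.2 hx).ne'
  rw [node]; field_simp; ring

lemma le_node (hx : x₁ < ω) (hρ : ω ^ 2 ≤ ρ) : ω ≤ node x₁ ω ρ := by
  rw [node_eq hx]
  have : 0 ≤ (ρ - ω ^ 2) / (ω - x₁) := div_nonneg (by linarith) (by linarith)
  linarith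

lemma wt_mul_node_sub (hx : x₁ < ω) (hρ : ω ^ 2 ≤ ρ) :
    wt x₁ ω ρ * (node x₁ ω ρ - x₁) = ω - x₁ := by
  have h1 := (sub_pos.2 hx).ne'
  have h2 := (denom_pos hx hρ).ne'
  have e : node x₁ ω ρ - x₁ = (ρ - 2 * ω * x₁ + x₁ ^ 2) / (ω - x₁) := by
    rw [node, eq_div_iff h1, sub_mul, div_mul_cancel₀ _ h1]; ring
  rw [e, wt, div_mul_div_comm, mul_comm (ρ - 2 * ω * x₁ + x₁ ^ 2) (ω - x₁),
    mul_div_mul_right _ _ h2, pow_two, mul_div_cancel_right₀ _ h1]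

/-- The mean of the two-point distribution is `ω`. -/
lemma wt_mean (hx : x₁ < ω) (hρ : ω ^ 2 ≤ ρ) :
    (1 - wt x₁ ω ρ) * x₁ + wt x₁ ω ρ * node x₁ ω ρ = ω := by
  linear_combination wt_mul_node_sub hx hρ

/-- The second moment of the two-point distribution is `ρ`. -/
lemma wt_second (hx : x₁ < ω) (hρ : ω ^ 2 ≤ ρ) :
    (1 - wt x₁ ω ρ) * x₁ ^ 2 + wt x₁ ω ρ * node x₁ ω ρ ^ 2 = ρ := by
  have e : node x₁ ω ρ * (ω - x₁) = ρ - ω * x₁ := div_mul_cancel₀ _ (sub_pos.2 hx).ne'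
  linear_combination (node x₁ ω ρ + x₁) * wt_mul_node_sub hx hρ + e

lemma mix_of_le (hx : x₁ < ω) (hρ : ω ^ 2 ≤ ρ) {y : ℝ} (hy : y ≤ x₁) :
    mix x₁ ω ρ y = ω - y := by
  rw [mix_eq hx hρ, tent_of_le hy, tent_of_le (by linarith [le_node hx hρ])]
  linear_combination wt_mean hx hρ

lemma mix_of_mem (hx : x₁ < ω) (hρ : ω ^ 2 ≤ ρ) {y : ℝ} (hy : x₁ ≤ y) (hy' : y ≤ node x₁ ω ρ) :
    mix x₁ ω ρ y = wt x₁ ω ρ * (node x₁ ω ρ - y) := by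
  rw [mix_eq hx hρ, tent_of_ge hy, tent_of_le hy']; ring

lemma mix_of_ge (hx : x₁ < ω) (hρ : ω ^ 2 ≤ ρ) {y : ℝ} (hy : node x₁ ω ρ ≤ y) :
    mix x₁ ω ρ y = 0 := by
  rw [mix_eq hx hρ, tent_of_ge hy, tent_of_ge (by linarith [le_node hx hρ])]; ring

lemma continuous_mix (x₁ ω ρ : ℝ) : Continuous (mix x₁ ω ρ) :=
  ((continuous_tent _).const_mul _).add ((continuous_tent _).const_mul _)

lemma mix_nonneg (hx : x₁ < ω) (hρ : ω ^ 2 ≤ ρ) (y : ℝ) : 0 ≤ mix x₁ ω ρ y := by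
  rw [mix_eq hx hρ]
  exact add_nonneg (mul_nonneg (by linarith [wt_le_one hx hρ]) (tent_nonneg _ _))
    (mul_nonneg (wt_pos hx hρ).le (tent_nonneg _ _))

lemma convexOn_mix (hx : x₁ < ω) (hρ : ω ^ 2 ≤ ρ) : ConvexOn ℝ univ (mix x₁ ω ρ) := by
  rw [funext (mix_eq hx hρ)]
  exact ((convexOn_tent _).smul (by linarith [wt_le_one hx hρ])).add
    ((convexOn_tent _).smul (wt_pos hx hρ).le)

lemma sub_le_mix (hx : x₁ < ω) (hρ : ω ^ 2 ≤ ρ) (y : ℝ) : ω - y ≤ mix x₁ ω ρ y := by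
  rw [mix_eq hx hρ]
  have h1 := mul_le_mul_of_nonneg_left (le_max_left (x₁ - y) 0)
    (by linarith [wt_le_one hx hρ] : 0 ≤ 1 - wt x₁ ω ρ)
  have h2 := mul_le_mul_of_nonneg_left (le_max_left (node x₁ ω ρ - y) 0) (wt_pos hx hρ).le
  have := wt_mean hx hρ
  rw [tent, tent]; linarith

lemma tent_le_mix (hx : x₁ < ω) (hρ : ω ^ 2 ≤ ρ) (y : ℝ) : tent ω y ≤ mix x₁ ω ρ y :=
  max_le (sub_le_mix hx hρ y) (mix_nonneg hx hρ y)

lemma integrableOn_mix (c x₁ ω ρ : ℝ) : IntegrableOn (mix x₁ ω ρ) (Ioi c) :=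
  ((integrableOn_tent c _).const_mul _).add ((integrableOn_tent c _).const_mul _)

lemma integral_mix_Ioi (hx : x₁ < ω) (hρ : ω ^ 2 ≤ ρ) (c : ℝ) :
    ∫ y in Ioi c, mix x₁ ω ρ y =
      ((1 - wt x₁ ω ρ) * max (x₁ - c) 0 ^ 2 + wt x₁ ω ρ * max (node x₁ ω ρ - c) 0 ^ 2) / 2 := by
  rw [funext (mix_eq hx hρ), integral_add ((integrableOn_tent c _).const_mul _)
    ((integrableOn_tent c _).const_mul _), integral_const_mul, integral_const_mul,
    integral_tent, integral_tent]
  ring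

lemma integral_mix (h0 : 0 ≤ x₁) (hx : x₁ < ω) (hρ : ω ^ 2 ≤ ρ) :
    ∫ y in Ioi 0, mix x₁ ω ρ y = ρ / 2 := by
  rw [integral_mix_Ioi hx hρ, max_eq_left (by linarith),
    max_eq_left (by linarith [le_node hx hρ])]
  simp only [sub_zero]
  rw [wt_second hx hρ]

lemma integral_mul_mix (hk : Measurable k) (hM : ∀ x, |k x| ≤ M) (h0 : 0 ≤ x₁) (hx : x₁ < ω)
    (hρ : ω ^ 2 ≤ ρ) :
    ∫ y in Ioi 0, k y * mix x₁ ω ρ y =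
      (ρ - ω ^ 2) / (ρ - 2 * ω * x₁ + x₁ ^ 2) * dblPrim k x₁
        + (ω - x₁) ^ 2 / (ρ - 2 * ω * x₁ + x₁ ^ 2) * dblPrim k ((ρ - ω * x₁) / (ω - x₁)) := by
  have hn : 0 ≤ (ρ - ω * x₁) / (ω - x₁) := h0.trans (hx.le.trans (le_node hx hρ))
  have e : ∀ y, k y * mix x₁ ω ρ y =
      (ρ - ω ^ 2) / (ρ - 2 * ω * x₁ + x₁ ^ 2) * (k y * tent x₁ y)
        + (ω - x₁) ^ 2 / (ρ - 2 * ω * x₁ + x₁ ^ 2)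
          * (k y * tent ((ρ - ω * x₁) / (ω - x₁)) y) := fun y => by rw [mix]; ring
  rw [funext e, integral_add, integral_const_mul, integral_const_mul, integral_mul_tent hk hM h0,
    integral_mul_tent hk hM hn]
  · exact (integrableOn_bdd_mul hk hM (integrableOn_tent 0 _)).const_mul _
  · exact (integrableOn_bdd_mul hk hM (integrableOn_tent 0 _)).const_mul _

end mix

/-! ### Normalised tails and their comparison with mixtures -/

/-- A normalised tail: a convex, continuous, non-negative, integrable function on `[0, ∞)` of value
`ω` at `0`, above the line `ω - x`, and of mass `ρ / 2`. -/
structure IsTail (F : ℝ → ℝ) (ω ρ : ℝ) : Prop where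
  convex : ConvexOn ℝ (Ici 0) F
  cont : ContinuousOn F (Ici 0)
  nonneg : ∀ x, 0 ≤ x → 0 ≤ F x
  integrable : IntegrableOn F (Ioi 0)
  zero : F 0 = ω
  le : ∀ x, 0 ≤ x → ω - x ≤ F x
  mass : ∫ x in Ioi 0, F x = ρ / 2

lemma integral_Ioi_split {f : ℝ → ℝ} {c : ℝ} (hc : 0 ≤ c) (hf : IntegrableOn f (Ioi 0)) :
    ∫ x in Ioi 0, f x = (∫ x in Ioc 0 c, f x) + ∫ x in Ioi c, f x := by
  rw [← Ioc_union_Ioi_eq_Ioi hc, setIntegral_union (Ioc_disjoint_Ioi le_rfl) measurableSet_Ioi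
    (hf.mono_set Ioc_subset_Ioi_self) (hf.mono_set (Ioi_subset_Ioi hc))]

/-- Vanishing holds almost everywhere first; continuity spreads it to every point, as no point of
`s` is isolated from the interior of `s`. -/
lemma eqOn_zero_of_integral_eq_zero {φ : ℝ → ℝ} {s : Set ℝ} (hs : MeasurableSet s)
    (hc : ContinuousOn φ s) (h0 : ∀ x ∈ s, 0 ≤ φ x) (hi : IntegrableOn φ s)
    (hz : ∫ x in s, φ x = 0) (hcl : s ⊆ closure (interior s)) : ∀ x ∈ s, φ x = 0 := by
  have h := (setIntegral_eq_zero_iff_of_nonneg_ae (ae_restrict_of_forall_mem hs h0) hi).1 hz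
  exact Measure.eqOn_of_ae_eq h hc continuousOn_const hcl

/-- If `k` is larger where `φ < 0` than where `φ > 0`, then `k * φ ≤ m * φ` for some
constant `m`. -/
lemma exists_const_mul_le {S : Set ℝ} {k φ : ℝ → ℝ} {M : ℝ} (hk0 : ∀ x, 0 ≤ k x)
    (hkM : ∀ x, k x ≤ M) (h : ∀ x ∈ S, ∀ y ∈ S, φ x < 0 → 0 < φ y → k y ≤ k x) :
    ∃ m, ∀ x ∈ S, k x * φ x ≤ m * φ x := by
  let A := k '' {x ∈ S | 0 < φ x}
  have hA : BddAbove A := ⟨M, by rintro _ ⟨x, _, rfl⟩; exact hkM x⟩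
  -- When `φ` is nowhere positive on `S`, `A` is empty and its `sSup` is the default `0`, which
  -- still lies below `k x`.
  refine ⟨sSup A, fun x hx => ?_⟩
  rcases lt_trichotomy (φ x) 0 with hneg | h0 | hpos
  · refine mul_le_mul_of_nonpos_right (Real.sSup_le ?_ (hk0 x)) hneg.le
    rintro _ ⟨y, ⟨hy, hy'⟩, rfl⟩
    exact h x hx y hy hneg hy'
  · simp [h0]
  · exact mul_le_mul_of_nonneg_right (le_csSup hA ⟨x, ⟨hx, hpos⟩, rfl⟩) hpos.le

/-- The constant `m` separating the values of `k` may replace `k`, and `m * φ` integrates to zero.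
-/
lemma setIntegral_mul_nonpos {S : Set ℝ} (hS : MeasurableSet S) {k φ : ℝ → ℝ} {M : ℝ}
    (hk : Measurable k) (hk0 : ∀ x, 0 ≤ k x)
    (hkM : ∀ x, k x ≤ M) (hφ : IntegrableOn φ S) (hz : ∫ x in S, φ x = 0)
    (h : ∀ x ∈ S, ∀ y ∈ S, φ x < 0 → 0 < φ y → k y ≤ k x) :
    ∫ x in S, k x * φ x ≤ 0 := by
  obtain ⟨m, hm⟩ := exists_const_mul_le hk0 hkM h
  calc ∫ x in S, k x * φ x ≤ ∫ x in S, m * φ x :=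
        setIntegral_mono_on (integrableOn_bdd_mul hk
          (fun x => by rw [abs_of_nonneg (hk0 x)]; exact hkM x) hφ) (hφ.const_mul m) hS hm
    _ = 0 := by rw [integral_const_mul, hz, mul_zero]

namespace IsTail

variable {F k : ℝ → ℝ} {ω ρ M c x₁ : ℝ}

lemma tent_le (hF : IsTail F ω ρ) {x : ℝ} (hx : 0 ≤ x) : tent ω x ≤ F x :=
  max_le (hF.le x hx) (hF.nonneg x hx)

lemma sq_le (hF : IsTail F ω ρ) (hω : 0 < ω) : ω ^ 2 ≤ ρ := by
  have h := setIntegral_mono_on (integrableOn_tent 0 ω) hF.integrable measurableSet_Ioi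
    (fun x hx => hF.tent_le (le_of_lt hx))
  rw [integral_tent, hF.mass, sub_zero, max_eq_left hω.le] at h
  linarith

/-- After a zero, a convex function that becomes positive at `y` stays at least `F y` from then on,
against integrability. -/
lemma eq_zero_of_le (hF : IsTail F ω ρ) {b y : ℝ} (hb : 0 ≤ b) (hb0 : F b = 0) (hy : b ≤ y) :
    F y = 0 := by
  by_contra hne
  have hpos : 0 < F y := lt_of_le_of_ne (hF.nonneg y (hb.trans hy)) (Ne.symm hne)
  have hge : ∀ x ∈ Ioi y, F y ≤ F x := by
    intro x hx
    have hx' : y < x := hx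
    have := hF.convex.le_max_of_mem_Icc (x := b) (y := x) (z := y) hb
      (by simp only [mem_Ici]; linarith) ⟨hy, hx'.le⟩
    rw [hb0] at this
    rcases le_max_iff.1 this with h | h
    · linarith
    · exact h
  have hi : IntegrableOn (fun _ : ℝ => F y) (Ioi y) := by
    refine Integrable.mono (hF.integrable.mono_set (Ioi_subset_Ioi (hb.trans hy)))
      aestronglyMeasurable_const (ae_restrict_of_forall_mem measurableSet_Ioi fun x hx => ?_)
    rw [Real.norm_of_nonneg hpos.le, Real.norm_of_nonneg (hpos.le.trans (hge x hx))]
    exact hge x hx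
  rw [integrableOn_const_iff] at hi
  simp [hne] at hi

lemma le_chord (hF : IsTail F ω ρ) {b x : ℝ} (hb : 0 < b) (hb0 : F b = 0) (hx : 0 ≤ x)
    (hxb : x ≤ b) : F x ≤ ω / b * tent b x := by
  have h1 : 0 ≤ 1 - x / b := by rw [sub_nonneg, div_le_one hb]; exact hxb
  have := hF.convex.2 (self_mem_Ici : (0 : ℝ) ∈ Ici 0) (mem_Ici.2 hb.le) h1
    (div_nonneg hx hb.le) (by ring)
  simp only [smul_eq_mul, mul_zero, zero_add, hF.zero, hb0, add_zero,
    div_mul_cancel₀ _ hb.ne'] at this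
  rw [tent_of_le hxb]
  refine this.trans (le_of_eq ?_)
  field_simp

lemma eq_tent (hF : IsTail F ω ρ) (hω : 0 < ω) (h0 : F ω = 0) {x : ℝ} (hx : 0 ≤ x) :
    F x = tent ω x := by
  rcases le_total x ω with h | h
  · refine le_antisymm ?_ (hF.tent_le hx)
    have := hF.le_chord hω h0 hx h
    rwa [div_self hω.ne', one_mul] at this
  · rw [tent_of_ge h]; exact hF.eq_zero_of_le hω.le h0 h

/-- Were `F ω = 0`, the chord from `(0, ω)` to `(ω, 0)` and the slope bound would pinch `F` onto the
tent, whose mass is only `ω ^ 2 / 2`. -/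
lemma pos_at (hF : IsTail F ω ρ) (hω : 0 < ω) (hρ : ω ^ 2 < ρ) : 0 < F ω := by
  refine lt_of_le_of_ne (hF.nonneg ω hω.le) fun h0 => ?_
  have h := hF.mass
  rw [setIntegral_congr_fun measurableSet_Ioi
    (fun x hx => hF.eq_tent hω h0.symm (le_of_lt hx)), integral_tent, sub_zero,
    max_eq_left hω.le] at h
  linarith

/-- The mixture is affine between its nodes. Hence a point lying between two points where `F` is at
most the mixture has the same property, which drives all the crossing arguments. -/
lemma convexOn_sub_mix (hF : IsTail F ω ρ) (h0 : 0 ≤ x₁) (hx : x₁ < ω) (hρ : ω ^ 2 ≤ ρ) :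
    ConvexOn ℝ (Icc x₁ (node x₁ ω ρ)) (fun y => F y - mix x₁ ω ρ y) := by
  have h1 : ConvexOn ℝ (Icc x₁ (node x₁ ω ρ)) F :=
    hF.convex.subset (fun y hy => h0.trans hy.1) (convex_Icc _ _)
  have h2 : ConcaveOn ℝ (Icc x₁ (node x₁ ω ρ)) (mix x₁ ω ρ) := by
    have : ConcaveOn ℝ (Icc x₁ (node x₁ ω ρ))
        (fun y => wt x₁ ω ρ * (node x₁ ω ρ - y)) := by
      refine ⟨convex_Icc _ _, fun x _ y _ p q _ _ hpq => le_of_eq ?_⟩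
      simp only [smul_eq_mul]
      linear_combination (wt x₁ ω ρ * node x₁ ω ρ) * hpq
    exact this.congr fun y hy => (mix_of_mem hx hρ hy.1 hy.2).symm
  exact h1.sub h2

lemma mix_le_of_le (hF : IsTail F ω ρ) (hx : x₁ < ω) (hρ : ω ^ 2 ≤ ρ) {y : ℝ} (h0 : 0 ≤ y)
    (hy : y ≤ x₁) : mix x₁ ω ρ y ≤ F y := by
  rw [mix_of_le hx hρ hy]; exact hF.le y h0

lemma mix_le_of_ge (hF : IsTail F ω ρ) (h0 : 0 ≤ x₁) (hx : x₁ < ω) (hρ : ω ^ 2 ≤ ρ) {y : ℝ}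
    (hy : node x₁ ω ρ ≤ y) : mix x₁ ω ρ y ≤ F y := by
  rw [mix_of_ge hx hρ hy]
  exact hF.nonneg y ((h0.trans hx.le).trans ((le_node hx hρ).trans hy))

lemma integrable_sub_mix (hF : IsTail F ω ρ) :
    IntegrableOn (fun y => F y - mix x₁ ω ρ y) (Ioi 0) :=
  hF.integrable.sub (integrableOn_mix 0 _ _ _)

lemma integral_sub_mix (hF : IsTail F ω ρ) (h0 : 0 ≤ x₁) (hx : x₁ < ω) (hρ : ω ^ 2 ≤ ρ) :
    ∫ y in Ioi 0, (F y - mix x₁ ω ρ y) = 0 := by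
  rw [integral_sub hF.integrable (integrableOn_mix 0 _ _ _), hF.mass, integral_mix h0 hx hρ,
    sub_self]

/-- A mixture crossing `F` downwards before the mode `c` and upwards after it, with the same mass
beyond `c`, has the larger objective. -/
lemma integral_mul_le_of_crossing (hF : IsTail F ω ρ) (hk : Measurable k) (hk0 : ∀ x, 0 ≤ k x)
    (hkM : ∀ x, k x ≤ M) (hc : 0 ≤ c) (hmono : MonotoneOn k (Ico 0 c))
    (hanti : AntitoneOn k (Ioi c)) (h0 : 0 ≤ x₁) (hx : x₁ < ω) (hρ : ω ^ 2 ≤ ρ)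
    (hc1 : x₁ ≤ c) (hc2 : c ≤ node x₁ ω ρ) (hcF : F c ≤ mix x₁ ω ρ c)
    (hmass : ∫ y in Ioi c, F y = ∫ y in Ioi c, mix x₁ ω ρ y) :
    ∫ y in Ioi 0, k y * F y ≤ ∫ y in Ioi 0, k y * mix x₁ ω ρ y := by
  set φ : ℝ → ℝ := fun y => F y - mix x₁ ω ρ y with hφ
  have hconv := hF.convexOn_sub_mix h0 hx hρ
  have hint : IntegrableOn φ (Ioi 0) := hF.integrable_sub_mix
  have hintc : IntegrableOn φ (Ioi c) := hint.mono_set (Ioi_subset_Ioi hc)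
  have hb : ∀ x, |k x| ≤ M := fun x => by rw [abs_of_nonneg (hk0 x)]; exact hkM x
  have hz2 : ∫ y in Ioi c, φ y = 0 := by
    rw [integral_sub (hF.integrable.mono_set (Ioi_subset_Ioi hc)) (integrableOn_mix c _ _ _),
      hmass, sub_self]
  -- The mode itself is dropped, since nothing is assumed about `k c`.
  have hz1 : ∫ y in Ioo 0 c, φ y = 0 := by
    have := integral_Ioi_split hc hint
    rw [hz2, hF.integral_sub_mix h0 hx hρ, integral_Ioc_eq_integral_Ioo] at this
    linarith
  have hcφ : φ c ≤ 0 := sub_nonpos.2 hcF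
  -- Before `c`, positive values of `φ` precede negative ones: a positive value between a negative
  -- one and `c`, where `φ c ≤ 0`, would contradict convexity. Monotonicity of `k` then orders the
  -- weights. Beyond `c` the picture is mirrored.
  have i1 : ∫ y in Ioo 0 c, k y * φ y ≤ 0 := by
    refine setIntegral_mul_nonpos measurableSet_Ioo hk hk0 hkM
      (hint.mono_set Ioo_subset_Ioi_self) hz1 fun x hx' y hy' hxneg hypos => ?_
    rcases le_or_gt y x with hyx | hxy
    · exact hmono ⟨hy'.1.le, hy'.2⟩ ⟨hx'.1.le, hx'.2⟩ hyx
    · exfalso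
      have hx1 : x₁ ≤ x := by
        by_contra hlt
        have := hF.mix_le_of_le hx hρ hx'.1.le (not_le.1 hlt).le
        simp only [hφ] at hxneg; linarith
      have := hconv.le_max_of_mem_Icc (x := x) (y := c) (z := y) ⟨hx1, hx'.2.le.trans hc2⟩
        ⟨hc1, hc2⟩ ⟨hxy.le, hy'.2.le⟩
      exact absurd (this.trans (max_le hxneg.le hcφ)) (not_le.2 hypos)
  have i2 : ∫ y in Ioi c, k y * φ y ≤ 0 := by
    refine setIntegral_mul_nonpos measurableSet_Ioi hk hk0 hkM hintc hz2
      fun x hx' y hy' hxneg hypos => ?_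
    rcases le_or_gt x y with hxy | hyx
    · exact hanti hx' hy' hxy
    · exfalso
      have hx2 : x ≤ node x₁ ω ρ := by
        by_contra hlt
        have := hF.mix_le_of_ge h0 hx hρ (not_le.1 hlt).le
        simp only [hφ] at hxneg; linarith
      have := hconv.le_max_of_mem_Icc (x := c) (y := x) (z := y) ⟨hc1, hc2⟩
        ⟨hc1.trans (le_of_lt hx'), hx2⟩ ⟨le_of_lt hy', hyx.le⟩
      exact absurd (this.trans (max_le hcφ hxneg.le)) (not_le.2 hypos)
  have htot := integral_Ioi_split hc (integrableOn_bdd_mul hk hb hint)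
  rw [integral_Ioc_eq_integral_Ioo] at htot
  have hsub : ∫ y in Ioi 0, k y * φ y =
      (∫ y in Ioi 0, k y * F y) - ∫ y in Ioi 0, k y * mix x₁ ω ρ y := by
    rw [← integral_sub (integrableOn_bdd_mul hk hb hF.integrable)
      (integrableOn_bdd_mul hk hb (integrableOn_mix 0 _ _ _))]
    simp only [hφ, mul_sub]
  linarith

/-- Among the mixtures, the one with first node `0` has the least mass beyond `c`. -/
lemma integral_mix_zero_le (hF : IsTail F ω ρ) (hω : 0 < ω) (hρ : ω ^ 2 ≤ ρ) (hc : 0 ≤ c) :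
    ∫ y in Ioi c, mix 0 ω ρ y ≤ ∫ y in Ioi c, F y := by
  have hconv := hF.convexOn_sub_mix le_rfl hω hρ
  have hint : IntegrableOn (fun y => F y - mix 0 ω ρ y) (Ioi 0) := hF.integrable_sub_mix
  have hF' := hF.integrable.mono_set (Ioi_subset_Ioi hc)
  suffices 0 ≤ ∫ y in Ioi c, (F y - mix 0 ω ρ y) by
    rw [integral_sub hF' (integrableOn_mix c _ _ _)] at this
    linarith
  -- The difference is zero at `0`. If it is negative somewhere beyond `c`, convexity makes it
  -- nonpositive on `[0, c]`, so the part beyond `c` must compensate.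
  by_cases hneg : ∃ y, c < y ∧ F y - mix 0 ω ρ y < 0
  · obtain ⟨y, hy, hy'⟩ := hneg
    have hyn : y ≤ node 0 ω ρ := by
      by_contra hlt
      have := hF.mix_le_of_ge le_rfl hω hρ (not_le.1 hlt).le
      linarith
    have h1 : ∫ x in Ioc 0 c, (F x - mix 0 ω ρ x) ≤ 0 := by
      refine setIntegral_nonpos measurableSet_Ioc fun x hx => ?_
      have := hconv.le_max_of_mem_Icc (x := 0) (y := y) (z := x)
        ⟨le_rfl, hω.le.trans (le_node hω hρ)⟩ ⟨hc.trans hy.le, hyn⟩ ⟨hx.1.le, hx.2.trans hy.le⟩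
      refine this.trans (max_le ?_ hy'.le)
      rw [hF.zero, mix_of_le hω hρ le_rfl]; simp
    have := integral_Ioi_split hc hint
    rw [hF.integral_sub_mix le_rfl hω hρ] at this
    linarith
  · push Not at hneg
    exact setIntegral_nonneg measurableSet_Ioi fun y hy => hneg y hy

end IsTail

/-! ### Dependence of the mixture on its first node -/

lemma continuousAt_wt {x₁ ω ρ : ℝ} (hd : ρ - 2 * ω * x₁ + x₁ ^ 2 ≠ 0) :
    ContinuousAt (fun x => wt x ω ρ) x₁ := by
  unfold wt
  exact ContinuousAt.div (by fun_prop) (by fun_prop) hd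

lemma tendsto_wt {ω ρ : ℝ} (hρ : ω ^ 2 < ρ) :
    Tendsto (fun x => wt x ω ρ) (𝓝[<] ω) (𝓝 0) := by
  have h := (continuousAt_wt (x₁ := ω) (ω := ω) (ρ := ρ) (by nlinarith)).tendsto
  simp only [wt, sub_self, ne_eq, OfNat.ofNat_ne_zero, not_false_eq_true, zero_pow, zero_div] at h
  exact h.mono_left nhdsWithin_le_nhds

lemma tendsto_node {ω ρ : ℝ} (hρ : ω ^ 2 < ρ) :
    Tendsto (fun x => node x ω ρ) (𝓝[<] ω) atTop := by
  have h1 : Tendsto (fun x => ω - x) (𝓝[<] ω) (𝓝[>] 0) := by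
    refine tendsto_nhdsWithin_iff.2 ⟨?_, ?_⟩
    · have : Tendsto (fun x => ω - x) (𝓝 ω) (𝓝 (ω - ω)) := by
        exact (continuous_const.sub continuous_id).tendsto ω
      rw [sub_self] at this
      exact this.mono_left nhdsWithin_le_nhds
    · exact eventually_mem_nhdsWithin.mono fun x hx => mem_Ioi.2 (sub_pos.2 hx)
  have h2 := (tendsto_inv_nhdsGT_zero.comp h1).const_mul_atTop (sub_pos.2 hρ)
  refine (tendsto_atTop_add_const_left _ ω h2).congr' ?_
  filter_upwards [eventually_mem_nhdsWithin] with x hx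
  rw [node_eq hx, div_eq_mul_inv]; rfl

lemma continuousOn_integral_mix_Ioi {ω ρ : ℝ} (hρ : ω ^ 2 ≤ ρ) (c : ℝ) :
    ContinuousOn (fun x => ∫ y in Ioi c, mix x ω ρ y) (Iio ω) := by
  have h1 : ContinuousOn (fun x => wt x ω ρ) (Iio ω) := fun x hx =>
    (continuousAt_wt (denom_pos hx hρ).ne').continuousWithinAt
  have h2 : ContinuousOn (fun x => node x ω ρ) (Iio ω) := by
    unfold node
    exact ContinuousOn.div (by fun_prop) (by fun_prop) fun x hx => (sub_pos.2 hx).ne'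
  refine ContinuousOn.congr (f := fun x => ((1 - wt x ω ρ) * max (x - c) 0 ^ 2
    + wt x ω ρ * max (node x ω ρ - c) 0 ^ 2) / 2) ?_ fun x hx => integral_mix_Ioi hx hρ c
  fun_prop

lemma tendsto_integral_mix_Ioi {ω ρ : ℝ} (hρ : ω ^ 2 < ρ) (c : ℝ) :
    Tendsto (fun x => ∫ y in Ioi c, mix x ω ρ y) (𝓝[<] ω)
      (𝓝 ((max (ω - c) 0 ^ 2 + (ρ - ω ^ 2)) / 2)) := by
  have hw := tendsto_wt hρ
  have hid : Tendsto (fun x : ℝ => x) (𝓝[<] ω) (𝓝 ω) := nhdsWithin_le_nhds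
  have hm : Tendsto (fun x : ℝ => max (x - c) 0) (𝓝[<] ω) (𝓝 (max (ω - c) 0)) :=
    (hid.sub_const c).max tendsto_const_nhds
  -- The upper node diverges while its weight vanishes. The moment identities replace weight times
  -- node, and weight times node squared, by expressions with visible limits.
  have hlim : Tendsto (fun x => ((1 - wt x ω ρ) * max (x - c) 0 ^ 2
      + (ρ - (1 - wt x ω ρ) * x ^ 2 - 2 * c * (ω - (1 - wt x ω ρ) * x) + c ^ 2 * wt x ω ρ)) / 2)
      (𝓝[<] ω) (𝓝 (((1 - 0) * max (ω - c) 0 ^ 2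
        + (ρ - (1 - 0) * ω ^ 2 - 2 * c * (ω - (1 - 0) * ω) + c ^ 2 * 0)) / 2)) := by
    have h1 := hw.const_sub 1
    exact (((h1.mul (hm.pow 2)).add ((((h1.mul (hid.pow 2)).const_sub ρ).sub
      (((h1.mul hid).const_sub ω).const_mul (2 * c))).add (hw.const_mul (c ^ 2)))).div_const 2)
  have e : (((1 - 0) * max (ω - c) 0 ^ 2
        + (ρ - (1 - 0) * ω ^ 2 - 2 * c * (ω - (1 - 0) * ω) + c ^ 2 * 0)) / 2)
      = (max (ω - c) 0 ^ 2 + (ρ - ω ^ 2)) / 2 := by ring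
  rw [e] at hlim
  refine hlim.congr' ?_
  filter_upwards [eventually_mem_nhdsWithin, (tendsto_node hρ).eventually_ge_atTop c] with x hx hn
  rw [integral_mix_Ioi hx hρ.le, max_eq_left (sub_nonneg.2 hn)]
  congr 2
  linear_combination 2 * c * wt_mean hx hρ.le - wt_second hx hρ.le

/-! ### Domination by a mixture: finite mode -/

namespace IsTail

variable {F k : ℝ → ℝ} {ω ρ M c : ℝ}

/-- Here `F` vanishes from `c` on, so it lies below the chord from `(0, ω)` to `(c, 0)`. Comparing
masses gives `ρ ≤ ω * c`, exactly what makes the first node nonnegative once the second is put at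
`c`. -/
lemma exists_node_eq (hF : IsTail F ω ρ) (hω : 0 < ω) (hρ : ω ^ 2 < ρ) (hc : 0 ≤ c)
    (hz : ∫ y in Ioi c, F y = 0) :
    ∃ x₁, 0 ≤ x₁ ∧ x₁ < ω ∧ node x₁ ω ρ = c ∧ F c = 0 := by
  have hFc : ∀ y ∈ Ici c, F y = 0 := by
    refine eqOn_zero_of_integral_eq_zero measurableSet_Ici
      (hF.cont.mono (Ici_subset_Ici.2 hc)) (fun x hx => hF.nonneg x (hc.trans hx)) ?_ ?_ ?_
    · rw [integrableOn_Ici_iff_integrableOn_Ioi]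
      exact hF.integrable.mono_set (Ioi_subset_Ioi hc)
    · rw [integral_Ici_eq_integral_Ioi, hz]
    · simp
  have hc0 := hFc c self_mem_Ici
  have hωc : ω < c := by
    by_contra h
    exact (hF.pos_at hω hρ).ne' (hFc ω (not_lt.1 h))
  have hcpos : 0 < c := hω.trans hωc
  have hchord : ∀ x ∈ Ioi (0 : ℝ), F x ≤ ω / c * tent c x := by
    intro x hx
    rcases le_total x c with h | h
    · exact hF.le_chord hcpos hc0 (le_of_lt hx) h
    · rw [hFc x h, tent_of_ge h, mul_zero]
  have hle := setIntegral_mono_on hF.integrable ((integrableOn_tent 0 c).const_mul (ω / c))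
    measurableSet_Ioi hchord
  rw [hF.mass, integral_const_mul, integral_tent, sub_zero, max_eq_left hc] at hle
  have e : ω / c * (c ^ 2 / 2) = ω * c / 2 := by field_simp
  rw [e] at hle
  have hd : 0 < c - ω := sub_pos.2 hωc
  have hs : 0 < ρ - ω ^ 2 := sub_pos.2 hρ
  have hx : ω - (ρ - ω ^ 2) / (c - ω) < ω := by
    have := div_pos hs hd; linarith
  -- The witness solves `ω + (ρ - ω ^ 2) / (ω - x₁) = c`.
  refine ⟨ω - (ρ - ω ^ 2) / (c - ω), ?_, hx, ?_, hc0⟩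
  · rw [sub_nonneg, div_le_iff₀ hd]; nlinarith
  · rw [node_eq hx, sub_sub_cancel, div_div_cancel₀ hs.ne']; ring

/-- If the mode of `k` is finite, every tail is dominated by a mixture of two tents. -/
lemma exists_mix_of_mode (hF : IsTail F ω ρ) (hω : 0 < ω) (hρ : ω ^ 2 < ρ) (hk : Measurable k)
    (hk0 : ∀ x, 0 ≤ k x) (hkM : ∀ x, k x ≤ M) (hc : 0 ≤ c) (hmono : MonotoneOn k (Ico 0 c))
    (hanti : AntitoneOn k (Ioi c)) :
    ∃ x₁, 0 ≤ x₁ ∧ x₁ < ω ∧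
      ∫ y in Ioi 0, k y * F y ≤ ∫ y in Ioi 0, k y * mix x₁ ω ρ y := by
  have main : ∀ {x₁}, 0 ≤ x₁ → x₁ < ω → x₁ ≤ c → c ≤ node x₁ ω ρ → F c ≤ mix x₁ ω ρ c →
      ∫ y in Ioi c, F y = ∫ y in Ioi c, mix x₁ ω ρ y → ∃ x₁, 0 ≤ x₁ ∧ x₁ < ω ∧
      ∫ y in Ioi 0, k y * F y ≤ ∫ y in Ioi 0, k y * mix x₁ ω ρ y :=
    fun h0 hx h1 h2 h3 h4 => ⟨_, h0, hx, hF.integral_mul_le_of_crossing hk hk0 hkM hc hmono hanti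
      h0 hx hρ.le h1 h2 h3 h4⟩
  have hFc := hF.integrable.mono_set (Ioi_subset_Ioi hc)
  have hF0 := hF.integrable.mono_set (Ioc_subset_Ioi_self : Ioc 0 c ⊆ Ioi 0)
  have hsplitF := integral_Ioi_split hc hF.integrable
  rw [hF.mass] at hsplitF
  have hsplitt := integral_Ioi_split hc (integrableOn_tent 0 ω)
  rw [integral_tent, integral_tent, sub_zero, max_eq_left hω.le] at hsplitt
  by_cases hz : ∫ y in Ioi c, F y = 0
  · obtain ⟨x₁, h0, hx, hn, hc0⟩ := hF.exists_node_eq hω hρ hc hz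
    refine main h0 hx ?_ hn.ge ?_ ?_
    · rw [← hn]; exact hx.le.trans (le_node hx hρ.le)
    · rw [hc0]; exact mix_nonneg hx hρ.le c
    · rw [hz, integral_mix_Ioi hx hρ.le, hn, sub_self, max_self,
        max_eq_right (by linarith [le_node hx hρ.le])]; ring
  have hle : ∫ x in Ioc 0 c, tent ω x ≤ ∫ x in Ioc 0 c, F x :=
    setIntegral_mono_on ((integrableOn_tent 0 ω).mono_set Ioc_subset_Ioi_self) hF0
      measurableSet_Ioc fun x hx => hF.tent_le hx.1.le
  -- With the first node at or past `c`, the mixture is the tent at `ω` on `[0, c]`, so its mass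
  -- beyond `c` is the largest any tail can have.
  have htail : ∀ {x₁}, 0 ≤ x₁ → x₁ < ω → c ≤ x₁ → ∫ y in Ioi c, mix x₁ ω ρ y =
      (max (ω - c) 0 ^ 2 + (ρ - ω ^ 2)) / 2 := by
    intro x₁ h0 hx hcx
    have h1 := integral_Ioi_split hc (integrableOn_mix 0 x₁ ω ρ)
    rw [integral_mix h0 hx hρ.le, setIntegral_congr_fun (g := tent ω) measurableSet_Ioc
      (fun y hy => by
        have hy' : y ≤ x₁ := hy.2.trans hcx
        simp only [mix_of_le hx hρ.le hy', tent_of_le (hy'.trans hx.le)])] at h1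
    linarith
  rcases hle.eq_or_lt with heq | hlt
  · have hzero : c = 0 ∨ ∀ x ∈ Icc 0 c, F x - tent ω x = 0 := by
      rcases hc.eq_or_lt with h | h
      · exact Or.inl h.symm
      refine Or.inr (eqOn_zero_of_integral_eq_zero measurableSet_Icc
        ((hF.cont.mono Icc_subset_Ici_self).sub (continuous_tent ω).continuousOn)
        (fun x hx => sub_nonneg.2 (hF.tent_le hx.1)) ?_ ?_ ?_)
      · rw [integrableOn_Icc_iff_integrableOn_Ioc]
        exact hF0.sub ((integrableOn_tent 0 ω).mono_set Ioc_subset_Ioi_self)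
      · rw [integral_Icc_eq_integral_Ioc,
          integral_sub hF0 ((integrableOn_tent 0 ω).mono_set Ioc_subset_Ioi_self), heq, sub_self]
      · rw [interior_Icc, closure_Ioo h.ne]
    have hcω : c < ω := by
      by_contra hge
      rcases hzero with h | h
      · exact hge (h ▸ hω)
      · have := h ω ⟨hω.le, not_lt.1 hge⟩
        rw [tent_of_ge le_rfl, sub_zero] at this
        exact (hF.pos_at hω hρ).ne' this
    have hval : F c = ω - c := by
      rcases hzero with h | h
      · rw [h, hF.zero, sub_zero]
      · rw [sub_eq_zero.1 (h c ⟨hc, le_rfl⟩), tent_of_le hcω.le]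
    refine main hc hcω le_rfl (hcω.le.trans (le_node hcω hρ.le)) ?_ ?_
    · rw [hval, mix_of_le hcω hρ.le le_rfl]
    · rw [htail hc hcω le_rfl]; linarith
  have hκ : ∫ y in Ioi c, F y < (max (ω - c) 0 ^ 2 + (ρ - ω ^ 2)) / 2 := by linarith
  have hb0' : ∀ᶠ b in 𝓝[<] ω, 0 < b := nhdsWithin_le_nhds (lt_mem_nhds hω)
  obtain ⟨b, hb, hb0, hbω⟩ := (((tendsto_integral_mix_Ioi hρ c).eventually (lt_mem_nhds hκ)).and
    (hb0'.and eventually_mem_nhdsWithin)).exists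
  -- The mass beyond `c` is at most that of `F` for `x₁ = 0` and exceeds it at `b`, so some `x₁` in
  -- between matches it.
  obtain ⟨x₁, ⟨h0, hxb⟩, hψ⟩ := intermediate_value_Icc hb0.le
    ((continuousOn_integral_mix_Ioi hρ.le c).mono fun x hx => lt_of_le_of_lt hx.2 hbω)
    ⟨hF.integral_mix_zero_le hω hρ.le hc, hb.le⟩
  have hψ : ∫ y in Ioi c, mix x₁ ω ρ y = ∫ y in Ioi c, F y := hψ
  have hx : x₁ < ω := lt_of_le_of_lt hxb hbω
  have hc1 : x₁ ≤ c := by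
    by_contra h
    have := htail h0 hx (not_le.1 h).le
    linarith
  have hc2 : c ≤ node x₁ ω ρ := by
    by_contra h
    apply hz
    rw [← hψ, integral_mix_Ioi hx hρ.le, max_eq_right (by linarith), max_eq_right (by linarith)]
    ring
  refine main h0 hx hc1 hc2 ?_ hψ.symm
  -- Suppose `F` lies above the mixture at `c`. A negative difference before `c` excludes one after
  -- `c`, by convexity. So the difference keeps one sign on one side of `c`, and its zero integral
  -- there forces it to vanish at `c`.
  by_contra hpos
  have hpos : 0 < F c - mix x₁ ω ρ c := sub_pos.2 (not_le.1 hpos)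
  have hconv := hF.convexOn_sub_mix h0 hx hρ.le
  have hint : IntegrableOn (fun y => F y - mix x₁ ω ρ y) (Ioi 0) := hF.integrable_sub_mix
  have hcont : ContinuousOn (fun y => F y - mix x₁ ω ρ y) (Ici 0) :=
    hF.cont.sub (continuous_mix _ _ _).continuousOn
  have hz2 : ∫ y in Ioi c, (F y - mix x₁ ω ρ y) = 0 := by
    rw [integral_sub hFc (integrableOn_mix c _ _ _), hψ, sub_self]
  have hz1 : ∫ y in Ioc 0 c, (F y - mix x₁ ω ρ y) = 0 := by
    have := integral_Ioi_split hc hint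
    rw [hz2, hF.integral_sub_mix h0 hx hρ.le] at this
    linarith
  by_cases hneg : ∃ y, 0 ≤ y ∧ y ≤ c ∧ F y - mix x₁ ω ρ y < 0
  · obtain ⟨y, hy0, hyc, hy⟩ := hneg
    have hy1 : x₁ ≤ y := by
      by_contra h
      have := hF.mix_le_of_le hx hρ.le hy0 (not_le.1 h).le
      linarith
    have := eqOn_zero_of_integral_eq_zero measurableSet_Ici
      (hcont.mono (Ici_subset_Ici.2 hc)) (fun z hz' => ?_) ?_ ?_ ?_ c self_mem_Ici
    · linarith
    · by_contra hzneg
      have hzneg := not_le.1 hzneg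
      have hzn : z ≤ node x₁ ω ρ := by
        by_contra h
        have := hF.mix_le_of_ge h0 hx hρ.le (not_le.1 h).le
        linarith
      have := hconv.le_max_of_mem_Icc (x := y) (y := z) (z := c) ⟨hy1, hyc.trans hc2⟩
        ⟨hc1.trans hz', hzn⟩ ⟨hyc, hz'⟩
      exact absurd (this.trans (max_le hy.le hzneg.le)) (not_le.2 hpos)
    · rw [integrableOn_Ici_iff_integrableOn_Ioi]
      exact hint.mono_set (Ioi_subset_Ioi hc)
    · rw [integral_Ici_eq_integral_Ioi, hz2]
    · simp
  · push Not at hneg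
    rcases hc.eq_or_lt with h | h
    · rw [← h, hF.zero, mix_of_le hx hρ.le h0] at hpos
      simp at hpos
    · have := eqOn_zero_of_integral_eq_zero measurableSet_Icc
        (hcont.mono Icc_subset_Ici_self) (fun z hz' => hneg z hz'.1 hz'.2) ?_ ?_ ?_ c
        ⟨hc, le_rfl⟩
      · linarith
      · rw [integrableOn_Icc_iff_integrableOn_Ioc]
        exact hint.mono_set Ioc_subset_Ioi_self
      · rw [integral_Icc_eq_integral_Ioc, hz1]
      · rw [interior_Icc, closure_Ioo h.ne]

end IsTail

/-! ### Quadratic growth of `H` and continuity of the value -/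

section limits

variable {k : ℝ → ℝ} {M L lam : ℝ}

lemma abs_le_of_bdd (hk0 : ∀ x, 0 ≤ k x) (hkM : ∀ x, k x ≤ M) (x : ℝ) : |k x| ≤ M := by
  rw [abs_of_nonneg (hk0 x)]; exact hkM x

lemma dblPrim_div_sq (hk : Measurable k) (hb : ∀ x, |k x| ≤ M) {x : ℝ} (hx : 0 < x) :
    dblPrim k x / x ^ 2 = ∫ s in Ioi 0, k (x * s) * tent 1 s := by
  have h := integral_comp_mul_left_Ioi (fun y => k y * tent x y) 0 hx
  rw [mul_zero, integral_mul_tent hk hb hx.le] at h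
  have e : ∀ s, k (x * s) * tent x (x * s) = x * (k (x * s) * tent 1 s) := by
    intro s
    have : tent x (x * s) = x * tent 1 s := by
      rw [tent, tent, mul_max_of_nonneg _ _ hx.le]
      congr 1 <;> ring
    rw [this]; ring
  rw [funext e, integral_const_mul, smul_eq_mul] at h
  rw [div_eq_iff (by positivity)]
  field_simp at h
  linarith

/-- Dominated convergence after rescaling `y = x * s`. As a bounded unimodal weight has a limit, `λ`
always exists, so the dichotomy needs no hypothesis on it. -/
lemma tendsto_dblPrim_div_sq (hk : Measurable k) (hb : ∀ x, |k x| ≤ M)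
    (hL : Tendsto k atTop (𝓝 L)) :
    Tendsto (fun x => dblPrim k x / x ^ 2) atTop (𝓝 (L / 2)) := by
  have h : Tendsto (fun x => ∫ s in Ioi 0, k (x * s) * tent 1 s) atTop
      (𝓝 (∫ s in Ioi 0, L * tent 1 s)) := by
    refine tendsto_integral_filter_of_dominated_convergence (fun s => M * tent 1 s)
      (Eventually.of_forall fun x => ?_) (Eventually.of_forall fun x => ?_)
      ((integrableOn_tent 0 1).const_mul M) ?_
    · exact ((hk.comp (measurable_const_mul x)).mul
        (continuous_tent 1).measurable).aestronglyMeasurable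
    · refine Eventually.of_forall fun s => ?_
      rw [norm_mul, Real.norm_eq_abs, Real.norm_of_nonneg (tent_nonneg 1 s)]
      exact mul_le_mul_of_nonneg_right (hb _) (tent_nonneg 1 s)
    · refine ae_restrict_of_forall_mem measurableSet_Ioi fun s hs => ?_
      exact (hL.comp (tendsto_id.atTop_mul_const hs)).mul_const _
  rw [integral_const_mul, integral_tent, sub_zero, max_eq_left zero_le_one] at h
  have e : L * (1 ^ 2 / 2) = L / 2 := by ring
  rw [e] at h
  refine h.congr' ?_
  filter_upwards [eventually_gt_atTop 0] with x hx
  exact (dblPrim_div_sq hk hb hx).symm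

lemma dblPrim_nonneg (hk : Measurable k) (hk0 : ∀ x, 0 ≤ k x) (hkM : ∀ x, k x ≤ M) {x : ℝ}
    (hx : 0 ≤ x) : 0 ≤ dblPrim k x := by
  rw [← integral_mul_tent hk (abs_le_of_bdd hk0 hkM) hx]
  exact integral_nonneg fun y => mul_nonneg (hk0 y) (tent_nonneg x y)

lemma dblPrim_le (hk : Measurable k) (hk0 : ∀ x, 0 ≤ k x) (hkM : ∀ x, k x ≤ M) {x : ℝ}
    (hx : 0 ≤ x) : dblPrim k x ≤ M * (x ^ 2 / 2) := by
  have hb := abs_le_of_bdd hk0 hkM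
  rw [← integral_mul_tent hk hb hx]
  have := integral_mono (integrableOn_bdd_mul hk hb (integrableOn_tent 0 x))
    ((integrableOn_tent 0 x).const_mul M)
    (fun y => mul_le_mul_of_nonneg_right (hkM y) (tent_nonneg x y))
  rwa [integral_const_mul, integral_tent, sub_zero, max_eq_left hx] at this

lemma dblPrim_mono (hk : Measurable k) (hk0 : ∀ x, 0 ≤ k x) (hkM : ∀ x, k x ≤ M) {x y : ℝ}
    (hx : 0 ≤ x) (hxy : x ≤ y) : dblPrim k x ≤ dblPrim k y := by
  have hb := abs_le_of_bdd hk0 hkM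
  rw [← integral_mul_tent hk hb hx, ← integral_mul_tent hk hb (hx.trans hxy)]
  exact integral_mono (integrableOn_bdd_mul hk hb (integrableOn_tent 0 x))
    (integrableOn_bdd_mul hk hb (integrableOn_tent 0 y))
    (fun z => mul_le_mul_of_nonneg_left (max_le_max (by linarith) le_rfl) (hk0 z))

lemma lam_nonneg (hk : Measurable k) (hk0 : ∀ x, 0 ≤ k x) (hkM : ∀ x, k x ≤ M)
    (hlam : Tendsto (fun x => dblPrim k x / x ^ 2) atTop (𝓝 lam)) : 0 ≤ lam := by
  refine ge_of_tendsto hlam ?_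
  filter_upwards [eventually_gt_atTop 0] with x hx
  exact div_nonneg (dblPrim_nonneg hk hk0 hkM hx.le) (by positivity)

lemma lam_le (hk : Measurable k) (hk0 : ∀ x, 0 ≤ k x) (hkM : ∀ x, k x ≤ M)
    (hlam : Tendsto (fun x => dblPrim k x / x ^ 2) atTop (𝓝 lam)) : lam ≤ M / 2 := by
  refine le_of_tendsto hlam ?_
  filter_upwards [eventually_gt_atTop 0] with x hx
  rw [div_le_iff₀ (by positivity)]
  have := dblPrim_le hk hk0 hkM hx.le
  linarith

/-- The normalised objective of the mixture, extended to `x = ω` by its limit. -/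
def val (k : ℝ → ℝ) (lam x ω ρ : ℝ) : ℝ :=
  if x = ω then dblPrim k ω + lam * (ρ - ω ^ 2)
  else (ρ - ω ^ 2) / (ρ - 2 * ω * x + x ^ 2) * dblPrim k x
    + (ω - x) ^ 2 / (ρ - 2 * ω * x + x ^ 2) * dblPrim k ((ρ - ω * x) / (ω - x))

variable {x ω ρ : ℝ}

lemma val_self (k : ℝ → ℝ) (lam ω ρ : ℝ) :
    val k lam ω ω ρ = dblPrim k ω + lam * (ρ - ω ^ 2) := if_pos rfl

lemma val_of_ne (hx : x ≠ ω) : val k lam x ω ρ =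
    (ρ - ω ^ 2) / (ρ - 2 * ω * x + x ^ 2) * dblPrim k x
    + (ω - x) ^ 2 / (ρ - 2 * ω * x + x ^ 2) * dblPrim k ((ρ - ω * x) / (ω - x)) := if_neg hx

lemma val_eq_integral (hk : Measurable k) (hb : ∀ x, |k x| ≤ M) (h0 : 0 ≤ x) (hx : x < ω)
    (hρ : ω ^ 2 ≤ ρ) : val k lam x ω ρ = ∫ y in Ioi 0, k y * mix x ω ρ y := by
  rw [val_of_ne hx.ne, integral_mul_mix hk hb h0 hx hρ]

lemma integral_mul_sub_tent {F : ℝ → ℝ} (hk : Measurable k) (hb : ∀ x, |k x| ≤ M) (hω : 0 ≤ ω)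
    (hF : IntegrableOn F (Ioi 0)) :
    ∫ y in Ioi 0, k y * (F y - tent ω y) = (∫ y in Ioi 0, k y * F y) - dblPrim k ω := by
  rw [← integral_mul_tent hk hb hω, ← integral_sub (integrableOn_bdd_mul hk hb hF)
    (integrableOn_bdd_mul hk hb (integrableOn_tent 0 ω))]
  simp only [mul_sub]

lemma integral_sub_tent {F : ℝ → ℝ} (hω : 0 ≤ ω) (hF : IntegrableOn F (Ioi 0))
    (hm : ∫ y in Ioi 0, F y = ρ / 2) :
    ∫ y in Ioi 0, (F y - tent ω y) = (ρ - ω ^ 2) / 2 := by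
  rw [integral_sub hF (integrableOn_tent 0 ω), hm, integral_tent, sub_zero, max_eq_left hω]
  ring

/-- Bounds on the objective of any function of mass `ρ / 2` above the tent at `ω`. -/
lemma integral_mul_bounds {F : ℝ → ℝ} (hk : Measurable k) (hk0 : ∀ x, 0 ≤ k x)
    (hkM : ∀ x, k x ≤ M) (hω : 0 ≤ ω) (hF : IntegrableOn F (Ioi 0))
    (hm : ∫ y in Ioi 0, F y = ρ / 2) (hle : ∀ y, 0 ≤ y → tent ω y ≤ F y) :
    dblPrim k ω ≤ ∫ y in Ioi 0, k y * F y ∧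
      ∫ y in Ioi 0, k y * F y ≤ dblPrim k ω + M / 2 * (ρ - ω ^ 2) := by
  have hb := abs_le_of_bdd hk0 hkM
  have h1 := integral_mul_sub_tent hk hb hω hF
  have h2 := integral_sub_tent hω hF hm
  have hφ := hF.sub (integrableOn_tent 0 ω)
  have h3 : 0 ≤ ∫ y in Ioi 0, k y * (F y - tent ω y) :=
    setIntegral_nonneg measurableSet_Ioi fun y hy =>
      mul_nonneg (hk0 y) (sub_nonneg.2 (hle y (le_of_lt hy)))
  have h4 : ∫ y in Ioi 0, k y * (F y - tent ω y) ≤ ∫ y in Ioi 0, M * (F y - tent ω y) :=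
    setIntegral_mono_on (integrableOn_bdd_mul hk hb hφ) (hφ.const_mul M) measurableSet_Ioi
      fun y hy => mul_le_mul_of_nonneg_right (hkM y) (sub_nonneg.2 (hle y (le_of_lt hy)))
  rw [integral_const_mul, h2] at h4
  constructor <;> linarith

/-- A mixture lies above the tent at `ω` with excess mass `(ρ - ω ^ 2) / 2`, weighted between `0`
and `M`; at `x = ω` the bounds `0 ≤ lam ≤ M / 2` play this part. The bounds close up as `ρ` tends to
`ω ^ 2`, where the formula may degenerate. -/
lemma val_bounds (hk : Measurable k) (hk0 : ∀ x, 0 ≤ k x) (hkM : ∀ x, k x ≤ M)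
    (hlam : Tendsto (fun x => dblPrim k x / x ^ 2) atTop (𝓝 lam)) (h0 : 0 ≤ x) (hx : x ≤ ω)
    (hρ : ω ^ 2 ≤ ρ) :
    dblPrim k ω ≤ val k lam x ω ρ ∧ val k lam x ω ρ ≤ dblPrim k ω + M / 2 * (ρ - ω ^ 2) := by
  rcases hx.eq_or_lt with rfl | hlt
  · rw [val_self]
    have h1 := lam_nonneg hk hk0 hkM hlam
    have h2 := lam_le hk hk0 hkM hlam
    have h3 := sub_nonneg.2 hρ
    constructor
    · nlinarith
    · nlinarith
  · rw [val_eq_integral hk (abs_le_of_bdd hk0 hkM) h0 hlt hρ]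
    exact integral_mul_bounds hk hk0 hkM (h0.trans hx) (integrableOn_mix 0 _ _ _)
      (integral_mix h0 hlt hρ) fun y _ => tent_le_mix hlt hρ y

lemma val_sq (hk : Measurable k) (hk0 : ∀ x, 0 ≤ k x) (hkM : ∀ x, k x ≤ M)
    (hlam : Tendsto (fun x => dblPrim k x / x ^ 2) atTop (𝓝 lam)) (h0 : 0 ≤ x) (hx : x ≤ ω) :
    val k lam x ω (ω ^ 2) = dblPrim k ω := by
  have := val_bounds hk hk0 hkM hlam h0 hx le_rfl
  rw [sub_self, mul_zero, add_zero] at this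
  exact le_antisymm this.2 this.1

/-- Scaling the nodes up does not decrease the objective. -/
lemma val_le_val_scale (hk : Measurable k) (hk0 : ∀ x, 0 ≤ k x) (hkM : ∀ x, k x ≤ M)
    (h0 : 0 ≤ x) (hx : x < ω) (hρ : ω ^ 2 ≤ ρ) {r : ℝ} (hr : 1 ≤ r) :
    val k lam x ω ρ ≤ val k lam (r * x) (r * ω) (r ^ 2 * ρ) := by
  have hr0 : r ≠ 0 := by positivity
  have hrx : r * x ≠ r * ω := fun h => hx.ne (mul_left_cancel₀ hr0 h)
  have hD := denom_pos hx hρ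
  have hu := sub_pos.2 hx
  have e0 : r ^ 2 * ρ - 2 * (r * ω) * (r * x) + (r * x) ^ 2
      = r ^ 2 * (ρ - 2 * ω * x + x ^ 2) := by ring
  have e1 : (r ^ 2 * ρ - (r * ω) ^ 2) / (r ^ 2 * ρ - 2 * (r * ω) * (r * x) + (r * x) ^ 2)
      = (ρ - ω ^ 2) / (ρ - 2 * ω * x + x ^ 2) := by
    rw [e0, ← mul_div_mul_left (ρ - ω ^ 2) _ (pow_ne_zero 2 hr0)]; congr 1; ring
  have e2 : (r * ω - r * x) ^ 2 / (r ^ 2 * ρ - 2 * (r * ω) * (r * x) + (r * x) ^ 2)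
      = (ω - x) ^ 2 / (ρ - 2 * ω * x + x ^ 2) := by
    rw [e0, ← mul_div_mul_left ((ω - x) ^ 2) _ (pow_ne_zero 2 hr0)]; congr 1; ring
  have e3 : (r ^ 2 * ρ - r * ω * (r * x)) / (r * ω - r * x)
      = r * ((ρ - ω * x) / (ω - x)) := by
    rw [← mul_sub, eq_comm, ← mul_div_assoc, ← mul_div_mul_left _ _ hr0]; congr 1; ring
  have hn : 0 ≤ (ρ - ω * x) / (ω - x) := h0.trans (hx.le.trans (le_node hx hρ))
  rw [val_of_ne hx.ne, val_of_ne hrx, e1, e2, e3]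
  refine add_le_add (mul_le_mul_of_nonneg_left ?_ (div_nonneg (by linarith) hD.le))
    (mul_le_mul_of_nonneg_left ?_ (div_nonneg (by positivity) hD.le))
  · exact dblPrim_mono hk hk0 hkM h0 (le_mul_of_one_le_left h0 hr)
  · exact dblPrim_mono hk hk0 hkM hn (le_mul_of_one_le_left hn hr)

/-- The objective tends to the value at `x = ω` as the first node approaches `ω`. -/
lemma tendsto_val_of_lt {α : Type*} {l : Filter α} {X Ω R : α → ℝ} (hk : Measurable k)
    (hb : ∀ x, |k x| ≤ M) (hlam : Tendsto (fun x => dblPrim k x / x ^ 2) atTop (𝓝 lam))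
    (hρ : ω ^ 2 < ρ) (hX : Tendsto X l (𝓝 ω)) (hΩ : Tendsto Ω l (𝓝 ω)) (hR : Tendsto R l (𝓝 ρ))
    (hlt : ∀ᶠ i in l, X i < Ω i) :
    Tendsto (fun i => val k lam (X i) (Ω i) (R i)) l (𝓝 (val k lam ω ω ρ)) := by
  have hs := sub_pos.2 hρ
  have hD : Tendsto (fun i => R i - 2 * Ω i * X i + X i ^ 2) l (𝓝 (ρ - ω ^ 2)) := by
    have := (hR.sub ((hΩ.const_mul 2).mul hX)).add (hX.pow 2)
    convert this using 2; ring
  have hS : Tendsto (fun i => R i - Ω i ^ 2) l (𝓝 (ρ - ω ^ 2)) := hR.sub (hΩ.pow 2)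
  have hN : Tendsto (fun i => R i - Ω i * X i) l (𝓝 (ρ - ω ^ 2)) := by
    have := hR.sub (hΩ.mul hX)
    convert this using 2; ring
  have hu : Tendsto (fun i => Ω i - X i) l (𝓝[>] 0) := by
    refine tendsto_nhdsWithin_iff.2 ⟨?_, hlt.mono fun i hi => mem_Ioi.2 (sub_pos.2 hi)⟩
    have := hΩ.sub hX
    rwa [sub_self] at this
  have hnode : Tendsto (fun i => (R i - Ω i * X i) / (Ω i - X i)) l atTop := by
    simp only [div_eq_mul_inv]
    exact hN.pos_mul_atTop hs (tendsto_inv_nhdsGT_zero.comp hu)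
  have h1 : Tendsto (fun i => (R i - Ω i ^ 2) / (R i - 2 * Ω i * X i + X i ^ 2)
      * dblPrim k (X i)) l (𝓝 ((ρ - ω ^ 2) / (ρ - ω ^ 2) * dblPrim k ω)) :=
    (hS.div hD hs.ne').mul (((continuous_dblPrim hk hb).tendsto ω).comp hX)
  -- The second summand is rewritten through `H(node) / node ^ 2`, whose limit is `lam`; the factors
  -- `Ω - X` cancel.
  have h2 : Tendsto (fun i => (R i - Ω i * X i) ^ 2 / (R i - 2 * Ω i * X i + X i ^ 2)
      * (dblPrim k ((R i - Ω i * X i) / (Ω i - X i))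
        / ((R i - Ω i * X i) / (Ω i - X i)) ^ 2)) l
      (𝓝 ((ρ - ω ^ 2) ^ 2 / (ρ - ω ^ 2) * lam)) :=
    ((hN.pow 2).div hD hs.ne').mul (hlam.comp hnode)
  have e : val k lam ω ω ρ = (ρ - ω ^ 2) / (ρ - ω ^ 2) * dblPrim k ω
      + (ρ - ω ^ 2) ^ 2 / (ρ - ω ^ 2) * lam := by
    rw [val_self, div_self hs.ne', pow_two (ρ - ω ^ 2), mul_div_cancel_right₀ _ hs.ne']; ring
  rw [e]
  refine (h1.add h2).congr' ?_
  filter_upwards [hlt, hN.eventually (lt_mem_nhds hs)] with i hi hNi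
  rw [val_of_ne hi.ne]
  congr 1
  have hu' := (sub_pos.2 hi).ne'
  generalize Ω i - X i = u at *
  generalize R i - Ω i * X i = n at *
  generalize dblPrim k (n / u) = d
  generalize R i - 2 * Ω i * X i + X i ^ 2 = D
  have hn := hNi.ne'
  field_simp

/-- The objective is jointly continuous in the parameters. -/
lemma continuousOn_val (hk : Measurable k) (hk0 : ∀ x, 0 ≤ k x) (hkM : ∀ x, k x ≤ M)
    (hlam : Tendsto (fun x => dblPrim k x / x ^ 2) atTop (𝓝 lam)) :
    ContinuousOn (fun q : ℝ × ℝ × ℝ => val k lam q.1 q.2.1 q.2.2)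
      {q | 0 ≤ q.1 ∧ q.1 ≤ q.2.1 ∧ q.2.1 ^ 2 ≤ q.2.2} := by
  have hb := abs_le_of_bdd hk0 hkM
  have hH := continuous_dblPrim hk hb
  rintro ⟨x, ω, ρ⟩ ⟨h0, hx, hρ⟩
  dsimp only at h0 hx hρ
  rcases hρ.eq_or_lt with heq | hlt
  · subst heq
    have hv := val_sq hk hk0 hkM hlam h0 hx
    rw [ContinuousWithinAt]
    dsimp only
    rw [hv]
    have hω : ContinuousAt (fun q : ℝ × ℝ × ℝ => dblPrim k q.2.1) (x, ω, ω ^ 2) :=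
      (hH.comp (continuous_fst.comp continuous_snd)).continuousAt
    have hup : ContinuousAt (fun q : ℝ × ℝ × ℝ => dblPrim k q.2.1 + M / 2 * (q.2.2 - q.2.1 ^ 2))
        (x, ω, ω ^ 2) := by
      refine hω.add ?_
      fun_prop
    have hup' := hup.tendsto
    simp only [sub_self, mul_zero, add_zero] at hup'
    refine tendsto_of_tendsto_of_tendsto_of_le_of_le' (hω.tendsto.mono_left nhdsWithin_le_nhds)
      (hup'.mono_left nhdsWithin_le_nhds) ?_ ?_
    · exact eventually_mem_nhdsWithin.mono fun q hq =>
        (val_bounds hk hk0 hkM hlam hq.1 hq.2.1 hq.2.2).1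
    · exact eventually_mem_nhdsWithin.mono fun q hq =>
        (val_bounds hk hk0 hkM hlam hq.1 hq.2.1 hq.2.2).2
  rcases hx.eq_or_lt with rfl | hxlt
  · have hset : {q : ℝ × ℝ × ℝ | 0 ≤ q.1 ∧ q.1 ≤ q.2.1 ∧ q.2.1 ^ 2 ≤ q.2.2} ⊆
        {q | q.1 < q.2.1} ∪ {q | q.1 = q.2.1} := fun q hq => hq.2.1.lt_or_eq
    refine ContinuousWithinAt.mono (ContinuousWithinAt.union ?_ ?_) hset
    · have hfst : Tendsto (fun q : ℝ × ℝ × ℝ => q.1) (𝓝[{q | q.1 < q.2.1}] (x, x, ρ)) (𝓝 x) :=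
        (continuous_fst.tendsto _).mono_left nhdsWithin_le_nhds
      have hsnd : Tendsto (fun q : ℝ × ℝ × ℝ => q.2.1) (𝓝[{q | q.1 < q.2.1}] (x, x, ρ))
          (𝓝 x) :=
        ((continuous_fst.comp continuous_snd).tendsto _).mono_left nhdsWithin_le_nhds
      have htrd : Tendsto (fun q : ℝ × ℝ × ℝ => q.2.2) (𝓝[{q | q.1 < q.2.1}] (x, x, ρ))
          (𝓝 ρ) :=
        ((continuous_snd.comp continuous_snd).tendsto _).mono_left nhdsWithin_le_nhds
      exact tendsto_val_of_lt hk hb hlam hlt hfst hsnd htrd eventually_mem_nhdsWithin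
    · have : ContinuousAt (fun q : ℝ × ℝ × ℝ => dblPrim k q.2.1 + lam * (q.2.2 - q.2.1 ^ 2))
          (x, x, ρ) := by fun_prop
      refine this.continuousWithinAt.congr (fun q hq => ?_) (val_self _ _ _ _)
      have hq : q.1 = q.2.1 := hq
      rw [hq, val_self]
  · have hD := (denom_pos hxlt hlt.le).ne'
    have hu := (sub_pos.2 hxlt).ne'
    have hc : ContinuousAt (fun q : ℝ × ℝ × ℝ =>
        (q.2.2 - q.2.1 ^ 2) / (q.2.2 - 2 * q.2.1 * q.1 + q.1 ^ 2) * dblPrim k q.1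
        + (q.2.1 - q.1) ^ 2 / (q.2.2 - 2 * q.2.1 * q.1 + q.1 ^ 2)
          * dblPrim k ((q.2.2 - q.2.1 * q.1) / (q.2.1 - q.1))) (x, ω, ρ) := by
      have hn : ContinuousAt (fun q : ℝ × ℝ × ℝ => (q.2.2 - q.2.1 * q.1) / (q.2.1 - q.1))
          (x, ω, ρ) := ContinuousAt.div (by fun_prop) (by fun_prop) hu
      have hw1 : ContinuousAt (fun q : ℝ × ℝ × ℝ =>
          (q.2.2 - q.2.1 ^ 2) / (q.2.2 - 2 * q.2.1 * q.1 + q.1 ^ 2)) (x, ω, ρ) :=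
        ContinuousAt.div (by fun_prop) (by fun_prop) hD
      have hw2 : ContinuousAt (fun q : ℝ × ℝ × ℝ =>
          (q.2.1 - q.1) ^ 2 / (q.2.2 - 2 * q.2.1 * q.1 + q.1 ^ 2)) (x, ω, ρ) :=
        ContinuousAt.div (by fun_prop) (by fun_prop) hD
      exact (hw1.mul (hH.continuousAt.comp continuousAt_fst)).add
        (hw2.mul (hH.continuousAt.comp hn))
    refine (hc.congr ?_).continuousWithinAt
    have : ∀ᶠ q : ℝ × ℝ × ℝ in 𝓝 (x, ω, ρ), q.1 < q.2.1 :=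
      (isOpen_lt continuous_fst (continuous_fst.comp continuous_snd)).mem_nhds hxlt
    filter_upwards [this] with q hq
    rw [val_of_ne hq.ne]

/-- For non-decreasing `k`, every tail is dominated by a mixture of two tents. -/
lemma IsTail.exists_mix_of_monotone {F : ℝ → ℝ} (hF : IsTail F ω ρ) (hω : 0 < ω)
    (hρ : ω ^ 2 < ρ) (hk : Measurable k) (hk0 : ∀ x, 0 ≤ k x) (hkM : ∀ x, k x ≤ M)
    (hmono : MonotoneOn k (Ici 0)) (hL : Tendsto k atTop (𝓝 L)) :
    ∃ x₁, 0 ≤ x₁ ∧ x₁ < ω ∧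
      ∫ y in Ioi 0, k y * F y ≤ ∫ y in Ioi 0, k y * mix x₁ ω ρ y := by
  have hb := abs_le_of_bdd hk0 hkM
  have hlim := tendsto_dblPrim_div_sq hk hb hL
  have hkL : ∀ x, 0 ≤ x → k x ≤ L := fun x hx => ge_of_tendsto hL <|
    (eventually_ge_atTop x).mono fun y hy => hmono hx (hx.trans hy : (0 : ℝ) ≤ y) hy
  set φ : ℝ → ℝ := fun y => F y - tent ω y with hφdef
  have hφ : IntegrableOn φ (Ioi 0) := hF.integrable.sub (integrableOn_tent 0 ω)
  have hφ0 : ∀ y, 0 ≤ y → 0 ≤ φ y := fun y hy => sub_nonneg.2 (hF.tent_le hy)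
  have hφm : ∫ y in Ioi 0, φ y = (ρ - ω ^ 2) / 2 := integral_sub_tent hω.le hF.integrable hF.mass
  have hkφ : ∫ y in Ioi 0, k y * φ y = (∫ y in Ioi 0, k y * F y) - dblPrim k ω :=
    integral_mul_sub_tent hk hb hω.le hF.integrable
  have hle : ∫ y in Ioi 0, k y * φ y ≤ L * ((ρ - ω ^ 2) / 2) := by
    rw [← hφm, ← integral_const_mul]
    exact setIntegral_mono_on (integrableOn_bdd_mul hk hb hφ) (hφ.const_mul L) measurableSet_Ioi
      fun y hy => mul_le_mul_of_nonneg_right (hkL y (le_of_lt hy)) (hφ0 y (le_of_lt hy))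
  rcases hle.eq_or_lt with heq | hlt
  -- Equality means that `k = L` almost everywhere where `F` exceeds the tent. This happens just to
  -- the left of `ω`, as `φ` is continuous and positive there, so some `y < ω` has `k y = L`.
  · have hzero : ∫ y in Ioi 0, (L - k y) * φ y = 0 := by
      simp only [sub_mul]
      rw [integral_sub (hφ.const_mul L) (integrableOn_bdd_mul hk hb hφ), integral_const_mul, hφm,
        heq, sub_self]
    have hint : IntegrableOn (fun y => (L - k y) * φ y) (Ioi 0) := by
      simp only [sub_mul]
      exact (hφ.const_mul L).sub (integrableOn_bdd_mul hk hb hφ)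
    have hae := (setIntegral_eq_zero_iff_of_nonneg_ae
      (ae_restrict_of_forall_mem measurableSet_Ioi fun y hy =>
        mul_nonneg (sub_nonneg.2 (hkL y (le_of_lt hy))) (hφ0 y (le_of_lt hy))) hint).1 hzero
    have hφω : 0 < φ ω := by
      simp only [hφdef, tent_of_ge le_rfl, sub_zero]; exact hF.pos_at hω hρ
    have hcont : ContinuousAt φ ω :=
      (hF.cont.continuousAt (Ici_mem_nhds hω)).sub (continuous_tent ω).continuousAt
    obtain ⟨d, hdω, hd⟩ := exists_Ioc_subset_of_mem_nhds
      (Filter.inter_mem (hcont.eventually (lt_mem_nhds hφω)) (lt_mem_nhds hω)) ⟨0, hω⟩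
    have hae' : ∀ᵐ y ∂(volume.restrict (Ioo d ω)), (L - k y) * φ y = 0 :=
      ae_restrict_of_ae_restrict_of_subset
        (fun y hy => (hd ⟨hy.1, hy.2.le⟩).2) hae
    have hne : NeBot (ae (volume.restrict (Ioo d ω))) := by
      rw [ae_neBot, ne_eq, Measure.restrict_eq_zero, Real.volume_Ioo]
      simpa using hdω
    obtain ⟨y, hy, hyd⟩ := (hae'.and (ae_restrict_mem measurableSet_Ioo)).exists
    have hy' := hd ⟨hyd.1, hyd.2.le⟩
    have hy0 : 0 < y := hy'.2
    have hky : k y = L := by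
      have h1 : 0 < φ y := hy'.1
      have := (mul_eq_zero.1 hy).resolve_right h1.ne'
      linarith
    -- With first node `y`, the excess of the mixture over the tent lives beyond `y`, where `k = L`
    -- by monotonicity; the upper bound is attained.
    refine ⟨y, hy0.le, hyd.2, ?_⟩
    have h1 := integral_mul_sub_tent hk hb hω.le (integrableOn_mix 0 y ω ρ)
    have h2 : ∫ z in Ioi 0, k z * (mix y ω ρ z - tent ω z) =
        ∫ z in Ioi 0, L * (mix y ω ρ z - tent ω z) := by
      refine setIntegral_congr_fun measurableSet_Ioi fun z hz => ?_
      rcases le_total z y with h | h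
      · rw [mix_of_le hyd.2 hρ.le h, tent_of_le (h.trans hyd.2.le)]; simp
      · have : k z = L := le_antisymm (hkL z (le_of_lt hz))
          (hky ▸ hmono hy0.le (le_of_lt hz : (0 : ℝ) ≤ z) h)
        rw [this]
    rw [integral_const_mul, integral_sub_tent hω.le (integrableOn_mix 0 y ω ρ)
      (integral_mix hy0.le hyd.2 hρ.le)] at h2
    linarith
  -- In the strict case the limit value at `x = ω` beats `F`, hence so does a mixture with first
  -- node close enough to `ω`.
  · have hid : Tendsto (fun x : ℝ => x) (𝓝[<] ω) (𝓝 ω) := nhdsWithin_le_nhds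
    have ht := tendsto_val_of_lt (X := fun x => x) hk hb hlim hρ hid tendsto_const_nhds
      tendsto_const_nhds eventually_mem_nhdsWithin
    have hlt' : ∫ y in Ioi 0, k y * F y < val k (L / 2) ω ω ρ := by
      rw [val_self]; linarith
    have hpos : ∀ᶠ x in 𝓝[<] ω, 0 < x := nhdsWithin_le_nhds (lt_mem_nhds hω)
    obtain ⟨x, hx, hx0, hxω⟩ :=
      ((ht.eventually (lt_mem_nhds hlt')).and (hpos.and eventually_mem_nhdsWithin)).exists
    refine ⟨x, hx0.le, hxω, ?_⟩
    rw [val_eq_integral hk hb hx0.le hxω hρ.le] at hx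
    exact hx.le

/-- `k` is non-decreasing before and non-increasing after a finite or infinite mode. -/
def Unimodal (k : ℝ → ℝ) : Prop :=
  MonotoneOn k (Ici 0) ∨ ∃ c, 0 ≤ c ∧ MonotoneOn k (Ico 0 c) ∧ AntitoneOn k (Ioi c)

lemma Unimodal.exists_tendsto (hu : Unimodal k) (hk0 : ∀ x, 0 ≤ k x) (hkM : ∀ x, k x ≤ M) :
    ∃ L, Tendsto k atTop (𝓝 L) := by
  rcases hu with h | ⟨c, hc, -, h⟩
  · have hm : Monotone (fun x => k (max x 0)) := fun x y hxy =>
      h (le_max_right _ _ : (0 : ℝ) ≤ _) (le_max_right _ _ : (0 : ℝ) ≤ _)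
        (max_le_max hxy le_rfl)
    refine ⟨_, (tendsto_atTop_ciSup hm ⟨M, by rintro _ ⟨x, rfl⟩; exact hkM _⟩).congr' ?_⟩
    filter_upwards [eventually_ge_atTop 0] with x hx
    rw [max_eq_left hx]
  -- Truncation at `c + 1` keeps the argument inside the open half-line where `k` is non-increasing.
  · have hm : Antitone (fun x => k (max x (c + 1))) := fun x y hxy =>
      h (mem_Ioi.2 (lt_of_lt_of_le (lt_add_one c) (le_max_right _ _)))
        (mem_Ioi.2 (lt_of_lt_of_le (lt_add_one c) (le_max_right _ _))) (max_le_max hxy le_rfl)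
    refine ⟨_, (tendsto_atTop_ciInf hm ⟨0, by rintro _ ⟨x, rfl⟩; exact hk0 _⟩).congr' ?_⟩
    filter_upwards [eventually_ge_atTop (c + 1)] with x hx
    rw [max_eq_left hx]

/-- Every tail is dominated by a mixture of two tents with the same value at `0` and mass. -/
theorem IsTail.exists_mix {F : ℝ → ℝ} (hF : IsTail F ω ρ) (hω : 0 < ω) (hk : Measurable k)
    (hk0 : ∀ x, 0 ≤ k x) (hkM : ∀ x, k x ≤ M) (hu : Unimodal k) :
    ∃ x₁, 0 ≤ x₁ ∧ x₁ < ω ∧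
      ∫ y in Ioi 0, k y * F y ≤ ∫ y in Ioi 0, k y * mix x₁ ω ρ y := by
  rcases (hF.sq_le hω).eq_or_lt with heq | hlt
  · refine ⟨0, le_rfl, hω, ?_⟩
    have h1 := (integral_mul_bounds hk hk0 hkM hω.le hF.integrable hF.mass
      fun y hy => hF.tent_le hy).2
    have h2 := (integral_mul_bounds hk hk0 hkM hω.le (integrableOn_mix 0 0 ω ρ)
      (integral_mix le_rfl hω heq.le) fun y _ => tent_le_mix hω heq.le y).1
    rw [← heq, sub_self] at h1
    linarith
  · rcases hu with h | ⟨c, hc, h1, h2⟩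
    · obtain ⟨L, hL⟩ := Unimodal.exists_tendsto (Or.inl h) hk0 hkM
      exact hF.exists_mix_of_monotone hω hlt hk hk0 hkM h hL
    · exact hF.exists_mix_of_mode hω hlt hk hk0 hkM hc h1 h2

end limits

/-! ### Translation to the origin and approximating sequences -/

lemma integral_Ici_shift (g : ℝ → ℝ) (a : ℝ) :
    ∫ x in Ici a, g x = ∫ y in Ioi 0, g (y + a) := by
  rw [integral_Ici_eq_integral_Ioi]
  have := (measurePreserving_add_right volume a).setIntegral_preimage_emb
    (MeasurableEquiv.addRight a).measurableEmbedding g (Ioi a)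
  rw [← this]
  simp

lemma integrableOn_Ici_shift {g : ℝ → ℝ} {a : ℝ} :
    IntegrableOn g (Ici a) ↔ IntegrableOn (fun y => g (y + a)) (Ioi 0) := by
  rw [integrableOn_Ici_iff_integrableOn_Ioi]
  have := (measurePreserving_add_right volume a).integrableOn_comp_preimage
    (MeasurableEquiv.addRight a).measurableEmbedding (f := g) (s := Ioi a)
  rw [← this]
  simp [Function.comp_def]

/-- From `x₁` on, the mixture never exceeds its value `ω - x₁` at `x₁`. So it converges to the tent
as `x₁` tends to `ω`, although its mass does not. -/
lemma mix_le_tent_add {x₁ ω ρ : ℝ} (hx : x₁ < ω) (hρ : ω ^ 2 ≤ ρ) (y : ℝ) :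
    mix x₁ ω ρ y ≤ tent ω y + (ω - x₁) := by
  have h0 := tent_nonneg ω y
  rcases le_total y x₁ with h | h
  · rw [mix_of_le hx hρ h, tent_of_le (h.trans hx.le)]; linarith
  rcases le_total y (node x₁ ω ρ) with h' | h'
  · rw [mix_of_mem hx hρ h h']
    have := mul_le_mul_of_nonneg_left (by linarith : node x₁ ω ρ - y ≤ node x₁ ω ρ - x₁)
      (wt_pos hx hρ).le
    rw [wt_mul_node_sub hx hρ] at this
    linarith
  · rw [mix_of_ge hx hρ h']; linarith

lemma node_mono {x x' ω ρ : ℝ} (hxx : x ≤ x') (hx : x' < ω) (hρ : ω ^ 2 ≤ ρ) :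
    node x ω ρ ≤ node x' ω ρ := by
  rw [node_eq hx, node_eq (hxx.trans_lt hx)]
  have := div_le_div_of_nonneg_left (sub_nonneg.2 hρ) (sub_pos.2 hx)
    (by linarith : ω - x' ≤ ω - x)
  linarith

/-- The weight is `u ^ 2 / (u ^ 2 + s)` with `u = ω - x` and `s = ρ - ω ^ 2`, non-decreasing in `u`.
-/
lemma wt_anti {x x' ω ρ : ℝ} (hxx : x ≤ x') (hx : x' < ω) (hρ : ω ^ 2 ≤ ρ) :
    wt x' ω ρ ≤ wt x ω ρ := by
  rw [wt, wt, div_le_div_iff₀ (denom_pos hx hρ) (denom_pos (hxx.trans_lt hx) hρ)]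
  have h1 : (ω - x') ^ 2 ≤ (ω - x) ^ 2 := pow_le_pow_left₀ (by linarith) (by linarith) 2
  have := mul_le_mul_of_nonneg_right h1 (sub_nonneg.2 hρ)
  nlinarith

/-- A sequence increasing to `ω`. -/
def approx (ω : ℝ) (n : ℕ) : ℝ := ω - ω * (1 / ((n : ℝ) + 1))

section approx

variable {ω : ℝ}

lemma approx_lt (hω : 0 < ω) (n : ℕ) : approx ω n < ω := by
  have : 0 < ω * (1 / ((n : ℝ) + 1)) := by positivity
  rw [approx]; linarith

lemma approx_nonneg (hω : 0 < ω) (n : ℕ) : 0 ≤ approx ω n := by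
  have h : 1 / ((n : ℝ) + 1) ≤ 1 := by
    rw [div_le_one (by positivity)]
    have : (0 : ℝ) ≤ n := n.cast_nonneg
    linarith
  have := mul_le_mul_of_nonneg_left h hω.le
  rw [approx]; linarith

lemma approx_mono (hω : 0 < ω) : Monotone (approx ω) := fun m n hmn => by
  have := mul_le_mul_of_nonneg_left (Nat.one_div_le_one_div (α := ℝ) hmn) hω.le
  rw [approx, approx]; linarith

lemma tendsto_approx (hω : 0 < ω) : Tendsto (approx ω) atTop (𝓝[<] ω) := by
  refine tendsto_nhdsWithin_iff.2 ⟨?_, Eventually.of_forall fun n => approx_lt hω n⟩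
  have := (tendsto_one_div_add_atTop_nhds_zero_nat (𝕜 := ℝ)).const_mul ω |>.const_sub ω
  rwa [mul_zero, sub_zero] at this

end approx

/-! ### Translation between the program and normalised tails -/

/-- The standing assumptions on the parameters and on `h`. -/
structure Standing (P : Params) (h : ℝ → ℝ) : Prop where
  βl : 0 < P.βl
  ηl : 0 < P.ηl
  β : P.βl ≤ P.βu
  η : P.ηl ≤ P.ηu
  ν : 0 < P.ν
  meas : Measurable h
  qc : QuasiConcave P.a h

/-- The pairs of normalised value at `a` and normalised mass admitted by the program. -/
structure Admissible (P : Params) (ω ρ : ℝ) : Prop where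
  value : ω ∈ Icc P.μl P.μu
  mass : ρ ∈ Icc P.σl P.σu
  sq_le : ω ^ 2 ≤ ρ

namespace Standing

variable {P : Params} {h f : ℝ → ℝ} {lam x ω ρ : ℝ}

lemma measurable_shift (S : Standing P h) : Measurable fun v => h (v + P.a) :=
  S.meas.comp (measurable_id.add_const _)

lemma unimodal (S : Standing P h) : Unimodal fun v => h (v + P.a) := by
  obtain ⟨-, -, c, hac, hm, ha⟩ := S.qc
  induction c with
  | bot => simp at hac
  | top =>
    refine Or.inl fun x hx y hy hxy => hm ⟨?_, EReal.coe_lt_top _⟩ ⟨?_, EReal.coe_lt_top _⟩ ?_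
    · have : 0 ≤ x := hx; linarith
    · have : 0 ≤ y := hy; linarith
    · linarith
  | coe c =>
    have hac : P.a ≤ c := EReal.coe_le_coe_iff.1 hac
    refine Or.inr ⟨c - P.a, by linarith, fun x hx y hy hxy => ?_, fun x hx y hy hxy => ?_⟩
    · exact hm ⟨by linarith [hx.1], EReal.coe_lt_coe_iff.2 (by linarith [hx.2])⟩
        ⟨by linarith [hy.1], EReal.coe_lt_coe_iff.2 (by linarith [hy.2])⟩ (by linarith)
    · have hx : c - P.a < x := hx
      have hy : c - P.a < y := hy
      exact ha (EReal.coe_lt_coe_iff.2 (by linarith)) (EReal.coe_lt_coe_iff.2 (by linarith))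
        (by linarith)

lemma μl_pos (S : Standing P h) : 0 < P.μl := div_pos S.ηl S.ν

lemma pos (S : Standing P h) (A : Admissible P ω ρ) : 0 < ω := S.μl_pos.trans_le A.value.1

lemma W_eq (P : Params) (h : ℝ → ℝ) (lam x ω ρ : ℝ) :
    P.W h lam x ω ρ = P.ν * val (fun v => h (v + P.a)) lam x ω ρ := by
  rw [Params.W, val, mul_ite]; rfl

lemma K_eq (hx : x < ω) (hρ : ω ^ 2 ≤ ρ) (y : ℝ) :
    P.K x ω ρ y = P.ν * mix x ω ρ (y - P.a) := by
  rw [Params.K]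
  split_ifs with h1 h2
  · rw [mix_of_le hx hρ (by linarith)]; ring
  · have h2' : y - P.a ≤ node x ω ρ := by rw [node]; linarith
    rw [mix_of_mem hx hρ (by linarith) h2']
    change _ - P.ν * wt x ω ρ * (y - P.a - x) = _
    linear_combination -P.ν * wt_mul_node_sub hx hρ
  · rw [mix_of_ge hx hρ (by rw [node]; linarith), mul_zero]

lemma triangle_eq (ω y : ℝ) : P.triangle ω y = P.ν * tent ω (y - P.a) := by
  rw [Params.triangle]
  split_ifs with h1
  · rw [tent_of_le (by linarith)]; ring
  · rw [tent_of_ge (by linarith), mul_zero]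

lemma obj_eq (P : Params) (h f : ℝ → ℝ) :
    P.obj h f = ∫ y in Ioi 0, h (y + P.a) * f (y + P.a) :=
  integral_Ici_shift _ _

lemma obj_K (S : Standing P h) (h0 : 0 ≤ x) (hx : x < ω) (hρ : ω ^ 2 ≤ ρ) (lam : ℝ) :
    P.obj h (P.K x ω ρ) = P.W h lam x ω ρ := by
  obtain ⟨hk0, ⟨M, hM⟩, -⟩ := S.qc
  rw [obj_eq, W_eq, val_eq_integral S.measurable_shift
    (abs_le_of_bdd (fun _ => hk0 _) fun _ => hM _) h0 hx hρ, ← integral_const_mul]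
  refine integral_congr_ae (Eventually.of_forall fun y => ?_)
  simp only [K_eq hx hρ, add_sub_cancel_right]
  ring

lemma continuous_K (hx : x < ω) (hρ : ω ^ 2 ≤ ρ) : Continuous (P.K x ω ρ) := by
  rw [funext (K_eq hx hρ)]
  exact ((continuous_mix x ω ρ).comp (continuous_id.sub continuous_const)).const_mul _

lemma feasible_K (S : Standing P h) (A : Admissible P ω ρ) (h0 : 0 ≤ x) (hx : x < ω) :
    P.Feasible (P.K x ω ρ) := by
  have hρ := A.sq_le
  have hν := S.ν
  have hval : P.K x ω ρ P.a = P.ν * ω := by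
    rw [K_eq hx hρ, sub_self, mix_of_le hx hρ h0, sub_zero]
  have hKs : (fun y => P.K x ω ρ (y + P.a)) = fun y => P.ν * mix x ω ρ y := by
    funext y; rw [K_eq hx hρ, add_sub_cancel_right]
  have hmass : ∫ y in Ici P.a, P.K x ω ρ y = P.ν * (ρ / 2) := by
    rw [integral_Ici_shift, hKs, integral_const_mul, integral_mix h0 hx hρ]
  refine ⟨?_, ?_, ?_, ?_, ?_, ?_, ?_⟩
  · rw [integrableOn_Ici_shift, hKs]
    exact (integrableOn_mix 0 _ _ _).const_mul _
  · rw [hmass]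
    have h1 := A.mass.1
    have h2 := A.mass.2
    rw [Params.σl, div_le_iff₀ hν] at h1
    rw [Params.σu, le_div_iff₀ hν] at h2
    constructor <;> linarith
  · rw [hval]
    have h1 := A.value.1
    have h2 := A.value.2
    rw [Params.μl, div_le_iff₀ hν] at h1
    rw [Params.μu, le_div_iff₀ hν] at h2
    constructor <;> linarith
  · exact (continuous_K hx hρ).continuousAt.tendsto.mono_left nhdsWithin_le_nhds
  -- If `x = 0` the first segment is degenerate and the right derivative is `-ν` times the weight of
  -- the second node, which is at most one.
  · rcases h0.eq_or_lt with rfl | hpos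
    · refine ⟨-(P.ν * wt 0 ω ρ), ?_, ?_⟩
      · have hd : HasDerivAt (fun y => P.ν * (wt 0 ω ρ * (node 0 ω ρ - (y - P.a))))
            (P.ν * (wt 0 ω ρ * (-1))) P.a :=
          ((((hasDerivAt_id P.a).sub_const P.a).const_sub (node 0 ω ρ)).const_mul
            (wt 0 ω ρ)).const_mul P.ν
        have e : P.ν * (wt 0 ω ρ * (-1)) = -(P.ν * wt 0 ω ρ) := by ring
        rw [e] at hd
        have hn : 0 < node 0 ω ρ := hx.trans_le (le_node hx hρ)
        refine hd.hasDerivWithinAt.congr_of_eventuallyEq ?_ ?_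
        · have : ∀ᶠ y in 𝓝[≥] P.a, y < node 0 ω ρ + P.a :=
            nhdsWithin_le_nhds (lt_mem_nhds' hn)
          filter_upwards [this, eventually_mem_nhdsWithin] with y hy hy'
          have hy' : P.a ≤ y := hy'
          rw [K_eq hx hρ, mix_of_mem hx hρ (by linarith) (by linarith)]
        · rw [K_eq hx hρ, mix_of_mem hx hρ (by linarith) (by linarith)]
      · have := mul_le_mul_of_nonneg_left (wt_le_one hx hρ) hν.le
        linarith
    · refine ⟨-P.ν, ?_, le_rfl⟩
      have hd : HasDerivAt (fun y => P.ν * (ω - (y - P.a))) (P.ν * (-1)) P.a :=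
        (((hasDerivAt_id P.a).sub_const P.a).const_sub ω).const_mul P.ν
      rw [mul_neg_one] at hd
      refine hd.hasDerivWithinAt.congr_of_eventuallyEq ?_ ?_
      · have : ∀ᶠ y in 𝓝[≥] P.a, y < x + P.a := nhdsWithin_le_nhds (lt_mem_nhds' hpos)
        filter_upwards [this] with y hy
        rw [K_eq hx hρ, mix_of_le hx hρ (by linarith)]
      · rw [K_eq hx hρ, mix_of_le hx hρ (by linarith)]
  · have hc : ConvexOn ℝ univ (P.K x ω ρ) := by
      rw [funext (K_eq hx hρ)]
      have := ((convexOn_mix hx hρ).translate_left (-P.a)).smul hν.le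
      simpa [Function.comp_def, sub_eq_add_neg] using this
    exact hc.subset (subset_univ _) (convex_Ici _)
  · intro y _
    rw [K_eq hx hρ]
    exact mul_nonneg hν.le (mix_nonneg hx hρ _)
where
  lt_mem_nhds' {n a : ℝ} (hn : 0 < n) : ∀ᶠ y in 𝓝 a, y < n + a := gt_mem_nhds (by linarith)

/-- Convexity puts `f` above its right tangent at `a`, and the bound on the right derivative makes
that tangent no steeper than `-ν`. -/
lemma isTail (S : Standing P h) (hf : P.Feasible f) :
    IsTail (fun y => f (y + P.a) / P.ν) (f P.a / P.ν) (2 * (∫ x in Ici P.a, f x) / P.ν) := by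
  have hν := S.ν
  obtain ⟨s, hs, hsν⟩ := hf.rightDeriv
  have hcont : ContinuousOn f (Ici P.a) := hf.convex.continuousOn_Ici hs.continuousWithinAt
  have hmaps : ∀ y ∈ Ici (0 : ℝ), y + P.a ∈ Ici P.a := fun y hy => by
    have : 0 ≤ y := hy
    simp only [mem_Ici]; linarith
  refine ⟨?_, ?_, ?_, ?_, ?_, ?_, ?_⟩
  · have h1 := (hf.convex.translate_left P.a).smul (inv_nonneg.2 hν.le)
    have e : (fun y => f (y + P.a) / P.ν) = fun y => P.ν⁻¹ • (f ∘ fun z => z + P.a) y := by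
      funext y; simp [div_eq_inv_mul]
    rw [e]
    refine h1.subset (fun y hy => ?_) (convex_Ici _)
    have := hmaps y hy
    simp only [mem_preimage, mem_Ici] at *
    linarith
  · exact (hcont.comp (continuous_id.add continuous_const).continuousOn hmaps).div_const _
  · exact fun y hy => div_nonneg (hf.nonneg _ (hmaps y hy)) hν.le
  · exact (integrableOn_Ici_shift.1 hf.integrable).div_const _
  · simp
  · intro y hy
    rcases hy.eq_or_lt with rfl | hpos
    · simp
    have hsl := hf.convex.le_slope_of_hasDerivWithinAt_Ioi (x := P.a) (y := y + P.a) self_mem_Ici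
      (hmaps y hy) (by linarith) (hs.mono Ioi_subset_Ici_self)
    rw [slope_def_field, add_sub_cancel_right, le_div_iff₀ hpos] at hsl
    rw [sub_le_iff_le_add, ← sub_le_iff_le_add', ← sub_div, div_le_iff₀ hν]
    have := mul_le_mul_of_nonneg_right hsν hy
    linarith
  · rw [integral_div, integral_Ici_shift]; ring

lemma admissible (S : Standing P h) (hf : P.Feasible f) :
    Admissible P (f P.a / P.ν) (2 * (∫ x in Ici P.a, f x) / P.ν) := by
  have hν := S.ν
  refine ⟨⟨?_, ?_⟩, ⟨?_, ?_⟩, ?_⟩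
  · exact div_le_div_of_nonneg_right hf.value.1 hν.le
  · exact div_le_div_of_nonneg_right hf.value.2 hν.le
  · exact div_le_div_of_nonneg_right (by linarith [hf.mass.1]) hν.le
  · exact div_le_div_of_nonneg_right (by linarith [hf.mass.2]) hν.le
  · exact (S.isTail hf).sq_le (div_pos (S.ηl.trans_le hf.value.1) hν)

lemma obj_eq_mul (S : Standing P h) (f : ℝ → ℝ) :
    P.obj h f = P.ν * ∫ y in Ioi 0, h (y + P.a) * (f (y + P.a) / P.ν) := by
  have := S.ν.ne'
  rw [obj_eq, ← integral_const_mul]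
  refine integral_congr_ae (Eventually.of_forall fun y => ?_)
  field_simp

/-- Every feasible function is dominated by a two-piece function with the same value and mass. -/
lemma exists_le_obj_K (S : Standing P h) (hf : P.Feasible f) :
    ∃ x, 0 ≤ x ∧ x < f P.a / P.ν ∧
      P.obj h f ≤ P.obj h (P.K x (f P.a / P.ν) (2 * (∫ x in Ici P.a, f x) / P.ν)) := by
  obtain ⟨hk0, ⟨M, hM⟩, -⟩ := S.qc
  have A := S.admissible hf
  obtain ⟨x, h0, hx, hle⟩ := (S.isTail hf).exists_mix (S.pos A) S.measurable_shift
    (fun _ => hk0 _) (fun _ => hM _) S.unimodal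
  refine ⟨x, h0, hx, ?_⟩
  rw [S.obj_eq_mul f, S.obj_K h0 hx A.sq_le 0, W_eq, val_eq_integral S.measurable_shift
    (abs_le_of_bdd (fun _ => hk0 _) fun _ => hM _) h0 hx A.sq_le]
  exact mul_le_mul_of_nonneg_left hle S.ν.le

/-- `K` is piecewise linear with two segments. -/
lemma isPiecewiseLinear_K (S : Standing P h) (h0 : 0 ≤ x) (hx : x < ω) (hρ : ω ^ 2 ≤ ρ) :
    IsPiecewiseLinear P.a 2 (P.K x ω ρ) ![P.a, x + P.a, node x ω ρ + P.a]
      ![P.ν * (ω + P.a), P.ν * wt x ω ρ * (node x ω ρ + P.a)] ![-P.ν, -(P.ν * wt x ω ρ)] := by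
  refine ⟨(continuous_K hx hρ).continuousOn, fun y _ => ?_, rfl, ?_, ?_, ?_⟩
  · rw [K_eq hx hρ]
    exact mul_nonneg S.ν.le (mix_nonneg hx hρ _)
  · refine Fin.monotone_iff_le_succ.2 fun i => ?_
    fin_cases i
    · simpa using h0
    · simpa using hx.le.trans (le_node hx hρ)
  · intro i y hy
    rw [K_eq hx hρ]
    fin_cases i
    · have hy2 : y ≤ x + P.a := hy.2
      rw [mix_of_le hx hρ (by linarith)]
      simp only [Fin.zero_eta, Fin.isValue, Matrix.cons_val_zero]
      ring
    · have hy1 : x + P.a ≤ y := hy.1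
      have hy2 : y ≤ node x ω ρ + P.a := hy.2
      rw [mix_of_mem hx hρ (by linarith) (by linarith)]
      simp only [Fin.mk_one, Fin.isValue, Matrix.cons_val_one, Matrix.cons_val_fin_one]
      ring
  · intro y hy
    have hy : node x ω ρ + P.a < y := hy
    rw [K_eq hx hρ, mix_of_ge hx hρ (by linarith), mul_zero]

/-! ### The optimal value -/

lemma le_optValue (hf : P.Feasible f) : (P.obj h f : EReal) ≤ P.optValue h :=
  le_iSup₂ (f := fun (g : ℝ → ℝ) (_ : g ∈ {g | P.Feasible g}) => (P.obj h g : EReal)) f hf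

lemma tendsto_W (S : Standing P h)
    (hlam : Tendsto (fun x => H P.a h x / x ^ 2) atTop (𝓝 lam)) (A : Admissible P ω ρ) :
    Tendsto (fun n => P.W h lam (approx ω n) ω ρ) atTop (𝓝 (P.W h lam ω ω ρ)) := by
  obtain ⟨hk0, ⟨M, hM⟩, -⟩ := S.qc
  have hω := S.pos A
  have hc := continuousOn_val S.measurable_shift (fun _ => hk0 _) (fun _ => hM _) hlam
    (ω, ω, ρ) ⟨hω.le, le_rfl, A.sq_le⟩
  have ht : Tendsto (fun n => (approx ω n, ω, ρ)) atTop
      (𝓝[{q : ℝ × ℝ × ℝ | 0 ≤ q.1 ∧ q.1 ≤ q.2.1 ∧ q.2.1 ^ 2 ≤ q.2.2}] (ω, ω, ρ)) := by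
    refine tendsto_nhdsWithin_iff.2 ⟨?_, Eventually.of_forall fun n =>
      ⟨approx_nonneg hω n, (approx_lt hω n).le, A.sq_le⟩⟩
    exact ((tendsto_approx hω).mono_right nhdsWithin_le_nhds).prodMk_nhds tendsto_const_nhds
  simp only [W_eq]
  exact (hc.tendsto.comp ht).const_mul _

/-- For `x = ω` no mixture realises the value; it is a limit of values at first nodes increasing to
`ω`. -/
lemma W_le_optValue (S : Standing P h)
    (hlam : Tendsto (fun x => H P.a h x / x ^ 2) atTop (𝓝 lam)) (A : Admissible P ω ρ)
    (h0 : 0 ≤ x) (hx : x ≤ ω) : (P.W h lam x ω ρ : EReal) ≤ P.optValue h := by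
  have hω := S.pos A
  rcases hx.eq_or_lt with rfl | hlt
  · refine le_of_tendsto ((continuous_coe_real_ereal.tendsto _).comp (S.tendsto_W hlam A))
      (Eventually.of_forall fun n => ?_)
    rw [Function.comp, ← S.obj_K (approx_nonneg hω n) (approx_lt hω n) A.sq_le]
    exact le_optValue (S.feasible_K A (approx_nonneg hω n) (approx_lt hω n))
  · rw [← S.obj_K h0 hlt A.sq_le]
    exact le_optValue (S.feasible_K A h0 hlt)

lemma isOptimal_K (S : Standing P h) (A : Admissible P ω ρ) (h0 : 0 ≤ x) (hx : x < ω)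
    (hopt : (P.W h lam x ω ρ : EReal) = P.optValue h) : P.IsOptimal h (P.K x ω ρ) := by
  refine ⟨S.feasible_K A h0 hx, fun g hg => ?_⟩
  rw [S.obj_K h0 hx A.sq_le lam, ← EReal.coe_le_coe_iff, hopt]
  exact le_optValue hg

lemma isOptimizingSeq_K (S : Standing P h)
    (hlam : Tendsto (fun x => H P.a h x / x ^ 2) atTop (𝓝 lam)) (A : Admissible P ω ρ)
    (hopt : (P.W h lam ω ω ρ : EReal) = P.optValue h) :
    P.IsOptimizingSeq h fun n => P.K (approx ω n) ω ρ := by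
  have hω := S.pos A
  refine ⟨fun n => S.feasible_K A (approx_nonneg hω n) (approx_lt hω n), ?_⟩
  rw [← hopt]
  simp only [fun n => S.obj_K (approx_nonneg hω n) (approx_lt hω n) A.sq_le lam]
  exact (continuous_coe_real_ereal.tendsto _).comp (S.tendsto_W hlam A)

lemma tendsto_K (S : Standing P h) (A : Admissible P ω ρ) (y : ℝ) :
    Tendsto (fun n => P.K (approx ω n) ω ρ y) atTop (𝓝 (P.triangle ω y)) := by
  have hω := S.pos A
  simp only [fun n => K_eq (P := P) (approx_lt hω n) A.sq_le y, triangle_eq]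
  refine Tendsto.const_mul _ (tendsto_of_tendsto_of_tendsto_of_le_of_le
    (tendsto_const_nhds (x := tent ω (y - P.a)))
    (h := fun n => tent ω (y - P.a) + (ω - approx ω n)) ?_
    (fun n => tent_le_mix (approx_lt hω n) A.sq_le _)
    (fun n => mix_le_tent_add (approx_lt hω n) A.sq_le _))
  have := (((tendsto_approx hω).mono_right nhdsWithin_le_nhds).const_sub ω).const_add
    (tent ω (y - P.a))
  rwa [sub_self, add_zero] at this

/-- If `lam ≤ 0`, escaping mass earns nothing, while any mixture earns at least the objective of the
tent at `ω`. This is why non-attainment needs `lam > 0`. -/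
lemma W_self_le_W_zero (S : Standing P h)
    (hlam : Tendsto (fun x => H P.a h x / x ^ 2) atTop (𝓝 lam)) (A : Admissible P ω ρ)
    (h0 : lam ≤ 0) : P.W h lam ω ω ρ ≤ P.W h lam 0 ω ρ := by
  obtain ⟨hk0, ⟨M, hM⟩, -⟩ := S.qc
  have hb := (val_bounds S.measurable_shift (fun _ => hk0 _) (fun _ => hM _) hlam le_rfl
    (S.pos A).le A.sq_le).1
  rw [W_eq, W_eq, val_self]
  refine mul_le_mul_of_nonneg_left ?_ S.ν.le
  have := mul_nonneg_of_nonpos_of_nonpos h0 (sub_nonpos.2 A.sq_le)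
  nlinarith

lemma admissible₁ (S : Standing P h) {q : ℝ × ℝ} (hq : q ∈ P.R₁) : Admissible P P.μu q.1 :=
  ⟨⟨div_le_div_of_nonneg_right S.η S.ν.le, le_rfl⟩, ⟨(le_max_left _ _).trans hq.1.1, hq.1.2⟩,
    (le_max_right _ _).trans hq.1.1⟩

lemma σu_pos (S : Standing P h) : 0 < P.σu :=
  div_pos (by linarith [S.βl, S.β]) S.ν

lemma admissible₂ (S : Standing P h) {q : ℝ × ℝ} (hq : q ∈ P.R₂) : Admissible P q.1 P.σu := by
  refine ⟨⟨hq.1.1, hq.1.2.trans (min_le_left _ _)⟩,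
    ⟨div_le_div_of_nonneg_right (by linarith [S.β]) S.ν.le, le_rfl⟩, ?_⟩
  have h1 : q.1 ≤ Real.sqrt P.σu := hq.1.2.trans (min_le_right _ _)
  have h2 : 0 ≤ q.1 := S.μl_pos.le.trans hq.1.1
  exact (Real.le_sqrt h2 S.σu_pos.le).1 h1

lemma exists_W_ge (S : Standing P h) (lam : ℝ) (hf : P.Feasible f) :
    (∃ q ∈ P.R₁, P.obj h f ≤ P.W₁ h lam q) ∨ ∃ q ∈ P.R₂, P.obj h f ≤ P.W₂ h lam q := by
  obtain ⟨hk0, ⟨M, hM⟩, -⟩ := S.qc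
  obtain ⟨x, h0, hx, hle⟩ := S.exists_le_obj_K hf
  have A := S.admissible hf
  generalize f P.a / P.ν = ω at *
  generalize 2 * (∫ x in Ici P.a, f x) / P.ν = ρ at *
  have hω := S.pos A
  have hρ : 0 < ρ := (pow_pos hω 2).trans_le A.sq_le
  rw [S.obj_K h0 hx A.sq_le lam, W_eq] at hle
  have key : ∀ r, 1 ≤ r → P.obj h f ≤ P.W h lam (r * x) (r * ω) (r ^ 2 * ρ) := fun r hr => by
    rw [W_eq]
    exact hle.trans (mul_le_mul_of_nonneg_left (val_le_val_scale S.measurable_shift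
      (fun _ => hk0 _) (fun _ => hM _) h0 hx A.sq_le hr) S.ν.le)
  have hq0 : 0 ≤ P.σu / ρ := div_nonneg S.σu_pos.le hρ.le
  have hq1 : 1 ≤ P.σu / ρ := (one_le_div hρ).2 A.mass.2
  -- The largest admissible stretch is the smaller of the two ratios; which one binds first decides
  -- between the two maximizations.
  rcases le_total (P.μu / ω) (Real.sqrt (P.σu / ρ)) with hc | hc
  · have hr : 1 ≤ P.μu / ω := (one_le_div hω).2 A.value.2
    have e : P.μu / ω * ω = P.μu := div_mul_cancel₀ _ hω.ne'
    have hk := key _ hr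
    have hr2 : 1 ≤ (P.μu / ω) ^ 2 := one_le_pow₀ hr
    rw [e] at hk
    refine Or.inl ⟨((P.μu / ω) ^ 2 * ρ, P.μu / ω * x), ⟨⟨max_le ?_ ?_, ?_⟩, ?_, ?_⟩, hk⟩
    · exact A.mass.1.trans (le_mul_of_one_le_left hρ.le hr2)
    · calc P.μu ^ 2 = (P.μu / ω) ^ 2 * ω ^ 2 := by rw [← mul_pow, e]
        _ ≤ _ := mul_le_mul_of_nonneg_left A.sq_le (by positivity)
    · rw [← le_div_iff₀ hρ]
      exact (Real.le_sqrt (by linarith) hq0).1 hc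
    · exact mul_nonneg (by linarith) h0
    · exact (mul_le_mul_of_nonneg_left hx.le (by linarith)).trans e.le
  · have hr : 1 ≤ Real.sqrt (P.σu / ρ) := Real.one_le_sqrt.2 hq1
    set r := Real.sqrt (P.σu / ρ) with hrdef
    have e : r ^ 2 * ρ = P.σu := by rw [hrdef, Real.sq_sqrt hq0, div_mul_cancel₀ _ hρ.ne']
    have hk := key _ hr
    rw [e] at hk
    refine Or.inr ⟨(r * ω, r * x), ⟨⟨?_, le_min ?_ ?_⟩, ?_, ?_⟩, hk⟩
    · exact A.value.1.trans (le_mul_of_one_le_left hω.le hr)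
    · exact (le_div_iff₀ hω).1 hc
    · refine Real.le_sqrt_of_sq_le ?_
      rw [mul_pow, ← e]
      exact mul_le_mul_of_nonneg_left A.sq_le (by positivity)
    · exact mul_nonneg (by linarith) h0
    · exact mul_le_mul_of_nonneg_left hx.le (by linarith)

lemma optValue_eq (S : Standing P h)
    (hlam : Tendsto (fun x => H P.a h x / x ^ 2) atTop (𝓝 lam)) :
    P.optValue h = max (P.M₁ h lam) (P.M₂ h lam) := by
  refine le_antisymm (iSup₂_le fun f hf => ?_) (max_le (iSup₂_le fun q hq => ?_)
    (iSup₂_le fun q hq => ?_))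
  · rcases S.exists_W_ge lam hf with ⟨q, hq, hle⟩ | ⟨q, hq, hle⟩
    · exact (EReal.coe_le_coe_iff.2 hle).trans (le_max_of_le_left
        (le_iSup₂ (f := fun (q : ℝ × ℝ) (_ : q ∈ P.R₁) => (P.W₁ h lam q : EReal)) q hq))
    · exact (EReal.coe_le_coe_iff.2 hle).trans (le_max_of_le_right
        (le_iSup₂ (f := fun (q : ℝ × ℝ) (_ : q ∈ P.R₂) => (P.W₂ h lam q : EReal)) q hq))
  · exact S.W_le_optValue hlam (S.admissible₁ hq) hq.2.1 hq.2.2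
  · exact S.W_le_optValue hlam (S.admissible₂ hq) hq.2.1 hq.2.2

lemma argmax₁_nonempty (S : Standing P h)
    (hlam : Tendsto (fun x => H P.a h x / x ^ 2) atTop (𝓝 lam)) (hne : P.R₁.Nonempty) :
    (P.Argmax₁ h lam).Nonempty := by
  obtain ⟨hk0, ⟨M, hM⟩, -⟩ := S.qc
  have hcomp : IsCompact P.R₁ := isCompact_Icc.prod isCompact_Icc
  refine hcomp.exists_isMaxOn hne ?_
  have hc := continuousOn_val S.measurable_shift (fun _ => hk0 _) (fun _ => hM _) hlam
  have : P.W₁ h lam = fun q => P.ν * val (fun v => h (v + P.a)) lam q.2 P.μu q.1 :=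
    funext fun q => W_eq _ _ _ _ _ _
  rw [this]
  refine ContinuousOn.const_mul (hc.comp (f := fun q : ℝ × ℝ => (q.2, P.μu, q.1)) ?_ ?_) _
  · fun_prop
  · exact fun q hq => ⟨hq.2.1, hq.2.2, (S.admissible₁ hq).sq_le⟩

lemma R₂_nonempty (S : Standing P h) (hlt : P.ηl ^ 2 < 2 * P.βu * P.ν) : P.R₂.Nonempty := by
  have hν := S.ν
  refine ⟨(P.μl, 0), ⟨le_rfl, le_min (div_le_div_of_nonneg_right S.η hν.le)
    (Real.le_sqrt_of_sq_le ?_)⟩, le_rfl, S.μl_pos.le⟩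
  rw [Params.μl, Params.σu, div_pow, div_le_div_iff₀ (by positivity) hν]
  nlinarith

lemma argmax₂_nonempty (S : Standing P h)
    (hlam : Tendsto (fun x => H P.a h x / x ^ 2) atTop (𝓝 lam))
    (hlt : P.ηl ^ 2 < 2 * P.βu * P.ν) : (P.Argmax₂ h lam).Nonempty := by
  obtain ⟨hk0, ⟨M, hM⟩, -⟩ := S.qc
  -- This region is not a product, since `x₁` ranges up to `ω`; it is compact as a closed subset of
  -- a rectangle.
  have hclosed : IsClosed P.R₂ := by
    have : P.R₂ = {q : ℝ × ℝ | P.μl ≤ q.1} ∩ {q | q.1 ≤ min P.μu (Real.sqrt P.σu)} ∩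
        ({q | 0 ≤ q.2} ∩ {q | q.2 ≤ q.1}) := by
      ext q; simp [Params.R₂]
    rw [this]
    exact ((isClosed_le continuous_const continuous_fst).inter
      (isClosed_le continuous_fst continuous_const)).inter
      ((isClosed_le continuous_const continuous_snd).inter
      (isClosed_le continuous_snd continuous_fst))
  have hcomp : IsCompact P.R₂ := (isCompact_Icc.prod isCompact_Icc :
    IsCompact (Icc P.μl (min P.μu (Real.sqrt P.σu)) ×ˢ
      Icc 0 (min P.μu (Real.sqrt P.σu)))).of_isClosed_subset hclosed
      fun q hq => ⟨hq.1, hq.2.1, hq.2.2.trans hq.1.2⟩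
  refine hcomp.exists_isMaxOn (S.R₂_nonempty hlt) ?_
  have hc := continuousOn_val S.measurable_shift (fun _ => hk0 _) (fun _ => hM _) hlam
  have : P.W₂ h lam = fun q => P.ν * val (fun v => h (v + P.a)) lam q.2 q.1 P.σu :=
    funext fun q => W_eq _ _ _ _ _ _
  rw [this]
  refine ContinuousOn.const_mul (hc.comp (f := fun q : ℝ × ℝ => (q.2, q.1, P.σu)) ?_ ?_) _
  · fun_prop
  · exact fun q hq => ⟨hq.2.1, hq.2.2, (S.admissible₂ hq).sq_le⟩

lemma M₁_eq {q : ℝ × ℝ} (hq : q ∈ P.Argmax₁ h lam) : P.M₁ h lam = P.W₁ h lam q :=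
  le_antisymm (iSup₂_le fun _ hp => EReal.coe_le_coe_iff.2 (hq.2 hp))
    (le_iSup₂ (f := fun (q : ℝ × ℝ) (_ : q ∈ P.R₁) => (P.W₁ h lam q : EReal)) q hq.1)

lemma M₂_eq {q : ℝ × ℝ} (hq : q ∈ P.Argmax₂ h lam) : P.M₂ h lam = P.W₂ h lam q :=
  le_antisymm (iSup₂_le fun _ hp => EReal.coe_le_coe_iff.2 (hq.2 hp))
    (le_iSup₂ (f := fun (q : ℝ × ℝ) (_ : q ∈ P.R₂) => (P.W₂ h lam q : EReal)) q hq.1)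

/-- The optimal value is `W` at some admissible point. -/
lemma exists_W_eq_optValue (S : Standing P h)
    (hlam : Tendsto (fun x => H P.a h x / x ^ 2) atTop (𝓝 lam))
    (hlt : P.ηl ^ 2 < 2 * P.βu * P.ν) :
    ∃ x ω ρ, Admissible P ω ρ ∧ 0 ≤ x ∧ x ≤ ω ∧ (P.W h lam x ω ρ : EReal) = P.optValue h := by
  obtain ⟨q, hq⟩ := S.argmax₂_nonempty hlam hlt
  rw [S.optValue_eq hlam]
  rcases le_or_gt (P.M₁ h lam) (P.M₂ h lam) with hle | hgt
  · rw [max_eq_right hle]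
    exact ⟨q.2, q.1, P.σu, S.admissible₂ hq.1, hq.1.2.1, hq.1.2.2, (M₂_eq hq).symm⟩
  · rw [max_eq_left hgt.le]
    have hne : P.R₁.Nonempty := by
      by_contra hemp
      rw [not_nonempty_iff_eq_empty] at hemp
      have : P.M₁ h lam = ⊥ := by rw [Params.M₁, hemp]; simp
      rw [this] at hgt
      exact not_lt_bot hgt
    obtain ⟨p, hp⟩ := S.argmax₁_nonempty hlam hne
    exact ⟨p.2, P.μu, p.1, S.admissible₁ hp.1, hp.1.2.1, hp.1.2.2, (M₁_eq hp).symm⟩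

lemma exists_lam (S : Standing P h) :
    ∃ lam, Tendsto (fun x => H P.a h x / x ^ 2) atTop (𝓝 lam) := by
  obtain ⟨hk0, ⟨M, hM⟩, -⟩ := S.qc
  obtain ⟨L, hL⟩ := S.unimodal.exists_tendsto (fun _ => hk0 _) (fun _ => hM _)
  exact ⟨L / 2, tendsto_dblPrim_div_sq S.measurable_shift
    (abs_le_of_bdd (fun _ => hk0 _) fun _ => hM _) hL⟩

/-- If the constraints leave no slack, all feasible functions are optimal. -/
lemma isOptimal_of_rigid (S : Standing P h) (hge : 2 * P.βu * P.ν ≤ P.ηl ^ 2)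
    (hf : P.Feasible f) : P.IsOptimal h f := by
  obtain ⟨hk0, ⟨M, hM⟩, -⟩ := S.qc
  have hν := S.ν
  have hσ : P.σu ≤ P.μl ^ 2 := by
    rw [Params.μl, Params.σu, div_pow, div_le_div_iff₀ hν (by positivity)]
    nlinarith
  -- The chain `μl ^ 2 ≤ ω ^ 2 ≤ ρ ≤ σu ≤ μl ^ 2` collapses, and with zero excess mass the objective
  -- is fixed.
  have hrig : ∀ {ω ρ}, Admissible P ω ρ → ω = P.μl ∧ ρ = P.μl ^ 2 := by
    intro ω ρ A
    have h1 : P.μl ^ 2 ≤ ω ^ 2 := pow_le_pow_left₀ S.μl_pos.le A.value.1 2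
    have h2 := A.mass.2
    have h3 := A.sq_le
    have h4 : ω ^ 2 = P.μl ^ 2 := le_antisymm (by linarith) h1
    exact ⟨(pow_left_inj₀ (S.pos A).le S.μl_pos.le two_ne_zero).1 h4, by linarith⟩
  have hobj : ∀ {g}, P.Feasible g → P.obj h g = P.ν * dblPrim (fun v => h (v + P.a)) P.μl := by
    intro g hg
    have T := S.isTail hg
    obtain ⟨e1, e2⟩ := hrig (S.admissible hg)
    rw [e1, e2] at T
    have hb := integral_mul_bounds S.measurable_shift (fun _ => hk0 _) (fun _ => hM _)
      S.μl_pos.le T.integrable T.mass fun y hy => T.tent_le hy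
    rw [sub_self, mul_zero, add_zero] at hb
    rw [S.obj_eq_mul, le_antisymm hb.2 hb.1]
  exact ⟨hf, fun g hg => by rw [hobj hf, hobj hg]⟩

/-! ### The dichotomy and the final assembly -/

lemma dichotomy (S : Standing P h) (hfeas : ∃ f, P.Feasible f) :
    (∃ f ∈ PL P.a 2, P.IsOptimal h f) ∨
      ((¬ ∃ f, P.IsOptimal h f) ∧
        ∃ (f : ℕ → ℝ → ℝ) (y : ℕ → Fin 3 → ℝ) (c d : ℕ → Fin 2 → ℝ),
          (∀ k, IsPiecewiseLinear P.a 2 (f k) (y k) (c k) (d k)) ∧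
          P.IsOptimizingSeq h f ∧
          (∀ k, y k 1 < y k 2 ∧ d k 1 < 0) ∧
          Monotone (fun k => y k 2) ∧ Tendsto (fun k => y k 2) atTop atTop ∧
          Monotone (fun k => d k 1) ∧ Tendsto (fun k => d k 1) atTop (𝓝 0)) := by
  obtain ⟨f₀, hf₀⟩ := hfeas
  by_cases hopt : ∃ f, P.IsOptimal h f
  · obtain ⟨f, hf, hmax⟩ := hopt
    obtain ⟨x, h0, hx, hle⟩ := S.exists_le_obj_K hf
    have A := S.admissible hf
    exact Or.inl ⟨_, ⟨_, _, _, S.isPiecewiseLinear_K h0 hx A.sq_le⟩, S.feasible_K A h0 hx,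
      fun g hg => (hmax g hg).trans hle⟩
  refine Or.inr ⟨hopt, ?_⟩
  have hlt : P.ηl ^ 2 < 2 * P.βu * P.ν := by
    by_contra hge
    exact hopt ⟨f₀, S.isOptimal_of_rigid (not_lt.1 hge) hf₀⟩
  obtain ⟨lam, hlam⟩ := S.exists_lam
  obtain ⟨x, ω, ρ, A, h0, hx, hW⟩ := S.exists_W_eq_optValue hlam hlt
  have hω := S.pos A
  -- A maximizer off the diagonal would give an optimal solution. If instead `ρ = ω ^ 2`, the value
  -- does not depend on the first node and node `0` is optimal. So `x = ω` and mass must escape.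
  obtain rfl : x = ω := by
    by_contra hne
    exact hopt ⟨_, S.isOptimal_K A h0 (lt_of_le_of_ne hx hne) hW⟩
  have hρ : x ^ 2 < ρ := by
    refine lt_of_le_of_ne A.sq_le fun heq => hopt ⟨_, S.isOptimal_K A le_rfl hω (lam := lam) ?_⟩
    obtain ⟨hk0, ⟨M, hM⟩, -⟩ := S.qc
    rw [← hW, W_eq, W_eq, ← heq,
      val_sq S.measurable_shift (fun _ => hk0 _) (fun _ => hM _) hlam le_rfl hω.le,
      val_sq S.measurable_shift (fun _ => hk0 _) (fun _ => hM _) hlam hω.le le_rfl]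
  refine ⟨_, _, _, _, fun n => S.isPiecewiseLinear_K (approx_nonneg hω n) (approx_lt hω n)
    A.sq_le, S.isOptimizingSeq_K hlam A hW, fun n => ⟨?_, ?_⟩, ?_, ?_, ?_, ?_⟩
  · have := (approx_lt hω n).trans_le (le_node (approx_lt hω n) A.sq_le)
    simpa using this
  · have := mul_pos S.ν (wt_pos (approx_lt hω n) A.sq_le)
    simpa using this
  · intro m n hmn
    have := node_mono (approx_mono hω hmn) (approx_lt hω n) A.sq_le
    simpa using this
  · exact tendsto_atTop_add_const_right _ _ ((tendsto_node hρ).comp (tendsto_approx hω))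
  · intro m n hmn
    have := mul_le_mul_of_nonneg_left
      (wt_anti (approx_mono hω hmn) (approx_lt hω n) A.sq_le) S.ν.le
    simpa using this
  · have := (((tendsto_wt hρ).comp (tendsto_approx hω)).const_mul P.ν).neg
    simpa using this

end Standing

end TailOpt

end

theorem theorem6 (P : TailOpt.Params) (h : ℝ → ℝ)
    (hβl : 0 < P.βl) (hβ : P.βl ≤ P.βu) (hηl : 0 < P.ηl) (hη : P.ηl ≤ P.ηu) (hν : 0 < P.ν)
    (hmeas : Measurable h) (hqc : TailOpt.QuasiConcave P.a h) :
    -- the dichotomy, with at most two line segments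
    ((∃ f, P.Feasible f) →
      (∃ f ∈ TailOpt.PL P.a 2, P.IsOptimal h f) ∨
      ((¬ ∃ f, P.IsOptimal h f) ∧
        ∃ (f : ℕ → ℝ → ℝ) (y : ℕ → Fin 3 → ℝ) (c d : ℕ → Fin 2 → ℝ),
          (∀ k, TailOpt.IsPiecewiseLinear P.a 2 (f k) (y k) (c k) (d k)) ∧
          P.IsOptimizingSeq h f ∧
          (∀ k, y k 1 < y k 2 ∧ d k 1 < 0) ∧
          Monotone (fun k => y k 2) ∧ Tendsto (fun k => y k 2) atTop atTop ∧
          Monotone (fun k => d k 1) ∧ Tendsto (fun k => d k 1) atTop (𝓝 0))) ∧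
    (P.ηl ^ 2 < 2 * P.βu * P.ν →
      ∀ lam : ℝ, Tendsto (fun x => TailOpt.H P.a h x / x ^ 2) atTop (𝓝 lam) →
        -- the optimal value
        ((P.R₁.Nonempty → (P.Argmax₁ h lam).Nonempty) ∧
          (P.Argmax₂ h lam).Nonempty ∧
          P.optValue h = max (P.M₁ h lam) (P.M₂ h lam)) ∧
        -- solutions when the first maximum is at least the second
        (P.M₂ h lam ≤ P.M₁ h lam →
          (∀ ρ x₁, (ρ, x₁) ∈ P.Argmax₁ h lam → x₁ < P.μu → P.IsOptimal h (P.K x₁ P.μu ρ)) ∧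
          ((¬ ∃ ρ x₁, (ρ, x₁) ∈ P.Argmax₁ h lam ∧ x₁ < P.μu) →
            (∃ f : ℕ → ℝ → ℝ, P.IsOptimizingSeq h f ∧
              ∀ x, P.a ≤ x → Tendsto (fun k => f k x) atTop (𝓝 (P.triangle P.μu x))) ∧
            0 < lam)) ∧
        -- solutions when the first maximum is smaller than the second
        (P.M₁ h lam < P.M₂ h lam →
          (∀ ω x₁, (ω, x₁) ∈ P.Argmax₂ h lam → x₁ < ω → P.IsOptimal h (P.K x₁ ω P.σu)) ∧
          ((¬ ∃ ω x₁, (ω, x₁) ∈ P.Argmax₂ h lam ∧ x₁ < ω) →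
            (∃ ω, (ω, ω) ∈ P.Argmax₂ h lam) ∧
            (∀ ω, (ω, ω) ∈ P.Argmax₂ h lam →
              ∃ f : ℕ → ℝ → ℝ, P.IsOptimizingSeq h f ∧
                ∀ x, P.a ≤ x → Tendsto (fun k => f k x) atTop (𝓝 (P.triangle ω x))) ∧
            0 < lam))) := by
  have S : TailOpt.Standing P h := ⟨hβl, hηl, hβ, hη, hν, hmeas, hqc⟩
  refine ⟨S.dichotomy, fun hlt lam hlam => ⟨⟨S.argmax₁_nonempty hlam,
    S.argmax₂_nonempty hlam hlt, S.optValue_eq hlam⟩, fun hle => ?_, fun hgt => ?_⟩⟩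
  · have hopt := S.optValue_eq hlam
    rw [max_eq_left hle] at hopt
    refine ⟨fun ρ x₁ hq hx => S.isOptimal_K (S.admissible₁ hq.1) hq.1.2.1 hx
      (by rw [hopt, TailOpt.Standing.M₁_eq hq]; rfl), fun hno => ?_⟩
    -- An empty range would make the first maximum `⊥`, below the second, which is a real number.
    have hne : P.R₁.Nonempty := by
      obtain ⟨p, hp⟩ := S.argmax₂_nonempty hlam hlt
      rw [TailOpt.Standing.M₂_eq hp] at hle
      by_contra hemp
      rw [not_nonempty_iff_eq_empty] at hemp
      have hbot : P.M₁ h lam = ⊥ := by rw [TailOpt.Params.M₁, hemp]; simp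
      rw [hbot] at hle
      exact absurd (le_bot_iff.1 hle) (EReal.coe_ne_bot _)
    obtain ⟨⟨ρ, x⟩, hq⟩ := S.argmax₁_nonempty hlam hne
    have A := S.admissible₁ hq.1
    obtain rfl : x = P.μu := by
      by_contra hx
      exact hno ⟨ρ, x, hq, lt_of_le_of_ne hq.1.2.2 hx⟩
    refine ⟨⟨_, S.isOptimizingSeq_K hlam A
      (by rw [hopt, TailOpt.Standing.M₁_eq hq]; rfl), fun y _ => S.tendsto_K A y⟩, ?_⟩
    -- With `lam ≤ 0` the same `ρ` with first node `0` would be a maximizer off the diagonal.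
    by_contra hlam0
    have hle0 := S.W_self_le_W_zero hlam A (not_lt.1 hlam0)
    exact hno ⟨ρ, 0, ⟨⟨hq.1.1, le_rfl, (S.pos A).le⟩, fun p hp => (hq.2 hp).trans hle0⟩, S.pos A⟩
  · have hopt := S.optValue_eq hlam
    rw [max_eq_right hgt.le] at hopt
    refine ⟨fun ω x₁ hq hx => S.isOptimal_K (S.admissible₂ hq.1) hq.1.2.1 hx
      (by rw [hopt, TailOpt.Standing.M₂_eq hq]; rfl), fun hno => ?_⟩
    obtain ⟨⟨ω, x⟩, hq⟩ := S.argmax₂_nonempty hlam hlt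
    have A := S.admissible₂ hq.1
    obtain rfl : x = ω := by
      by_contra hx
      exact hno ⟨ω, x, hq, lt_of_le_of_ne hq.1.2.2 hx⟩
    refine ⟨⟨x, hq⟩, fun ω hω => ⟨_, S.isOptimizingSeq_K hlam (S.admissible₂ hω.1)
      (by rw [hopt, TailOpt.Standing.M₂_eq hω]; rfl),
      fun y _ => S.tendsto_K (S.admissible₂ hω.1) y⟩, ?_⟩
    by_contra hlam0
    have hle0 := S.W_self_le_W_zero hlam A (not_lt.1 hlam0)
    exact hno ⟨x, 0, ⟨⟨hq.1.1, le_rfl, (S.pos A).le⟩, fun p hp => (hq.2 hp).trans hle0⟩, S.pos A⟩
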